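/- Theorem 4.5. Let $k$ be a field, let $p \neq \operatorname{char} k$ be a prime number, and let $G$ be a group of order $p$ (so $G \cong \mathbb{Z}/p\mathbb{Z}$) acting by $k$-automorphisms on a smooth quasi-projective $k$-scheme $X$ (that is, $X$ is smooth over $k$ and admits a locally closed immersion over $k$ into some projective space $\mathbb{P}^n_k$). Let $X^G$ be the scheme-theoretic fixed locus, i.e. the fibre product over $k$ of the two morphisms $X \to \prod_{g \in G} X$, $x \mapsto (x)_g$ and $x \mapsto (gx)_g$. Assume that $X^G \subset X$ is a divisor, i.e. (possibly empty) a closed subscheme whose ideal sheaf is locally generated by one nonzerodivisor. Then the quotient $X/G$ exists as a $k$-scheme and is smooth over $k$. Here $X/G$ is a $k$-scheme $Y$ with an affine $G$-invariant $k$-morphism $\pi : X \to Y$ such that $Y$ is the topological quotient of $X$ by $G$ and $\mathcal{O}_Y = (\pi_* \mathcal{O}_X)^G$; every such $Y$ is smooth over $k$. -/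

import Mathlib

open CategoryTheory CategoryTheory.Limits AlgebraicGeometry

universe u v

noncomputable section

namespace QuotientSmoothness

attribute [local instance] MvPolynomial.gradedAlgebra

/-- Projective space `ℙⁿ` over a field `k`, as the `k`-scheme `Proj k[x₀, …, xₙ]`. -/
def projectiveSpace (k : Type u) [Field k] (n : ℕ) : Over (Spec (CommRingCat.of k)) :=
  Over.mk (Y := Proj (MvPolynomial.homogeneousSubmodule (Fin (n + 1)) k))
    (Proj.toSpecZero (MvPolynomial.homogeneousSubmodule (Fin (n + 1)) k) ≫
      Spec.map (CommRingCat.ofHom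
        (algebraMap k (MvPolynomial.homogeneousSubmodule (Fin (n + 1)) k 0))))

/-- A `k`-scheme is quasi-projective if it admits a (locally closed) immersion over `k` into
some projective space `ℙⁿ` over `k`. -/
def IsQuasiProjective {k : Type u} [Field k] (X : Over (Spec (CommRingCat.of k))) : Prop :=
  ∃ (n : ℕ) (i : X ⟶ projectiveSpace k n), IsImmersion i.left

section Action

variable {S : Scheme.{u}} {G : Type v} [Group G]

/-- The automorphism `x ↦ g x` of `X` given by an action `ρ` of `G` on the `S`-scheme `X`. -/
def act {X : Over S} (ρ : G →* Aut X) (g : G) : X ⟶ X :=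
  Iso.hom (ρ g)

/-- The fixed locus `X^G` of an action `ρ` of a finite group `G` on an `S`-scheme `X`: the fibre
product over `S` of the diagonal `x ↦ (x)_g` and of `x ↦ (g x)_g`, both from `X` to the product
over `S` of copies of `X` indexed by `G`. -/
def fixedLocus [Finite G] {X : Over S} (ρ : G →* Aut X) : Over S :=
  pullback (Pi.lift fun _ : G => 𝟙 X) (Pi.lift fun g : G => act ρ g)

/-- The canonical morphism `X^G ⟶ X`. -/
def fixedLocusι [Finite G] {X : Over S} (ρ : G →* Aut X) : fixedLocus ρ ⟶ X :=
  pullback.fst (Pi.lift fun _ : G => 𝟙 X) (Pi.lift fun g : G => act ρ g)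

/-- If `π` is a `G`-invariant morphism, the preimage under `π` of an open set is stable
under `G`. -/
theorem preimage_le_preimage {X Y : Over S} {ρ : G →* Aut X} {π : X ⟶ Y}
    (h : ∀ g, act ρ g ≫ π = π) (g : G) (V : Y.left.Opens) :
    π.left ⁻¹ᵁ V ≤ (act ρ g).left ⁻¹ᵁ (π.left ⁻¹ᵁ V) := by
  have e : (act ρ g).left ≫ π.left = π.left := by rw [← Over.comp_left, h g]
  rw [← Scheme.Hom.comp_preimage, e]

/-- `π : X ⟶ Y` exhibits `Y` as the quotient `X/G` of the `S`-scheme `X` by the action `ρ`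
of `G`: it is affine and `G`-invariant, `Y` is the topological quotient of `X` by `G`, and the
structure sheaf of `Y` is the sheaf of `G`-invariants of `π_* 𝒪_X`. -/
structure IsQuotient {X Y : Over S} (ρ : G →* Aut X) (π : X ⟶ Y) : Prop where
  isAffineHom : IsAffineHom π.left
  invariant : ∀ g, act ρ g ≫ π = π
  isQuotientMap : Topology.IsQuotientMap π.left
  exists_of_eq : ∀ x x' : X.left, π.left x = π.left x' → ∃ g, (act ρ g).left x = x'
  app_injective : ∀ V : Y.left.Opens, Function.Injective (π.left.app V)
  range_app : ∀ V : Y.left.Opens, Set.range (π.left.app V) =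
    {a | ∀ g, (act ρ g).left.appLE (π.left ⁻¹ᵁ V) (π.left ⁻¹ᵁ V)
      (preimage_le_preimage invariant g V) a = a}

end Action

/-- A morphism `i : D ⟶ X` is (the inclusion of) an effective Cartier divisor if it is a closed
immersion whose ideal sheaf is locally generated by a single nonzerodivisor. -/
structure IsEffectiveCartierDivisor {D X : Scheme.{u}} (i : D ⟶ X) : Prop where
  isClosedImmersion : IsClosedImmersion i
  exists_generator : ∀ x : X, ∃ U : X.affineOpens, x ∈ U.1 ∧
    ∃ t ∈ nonZeroDivisors Γ(X, U), i.ker.ideal U = Ideal.span {t}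

end QuotientSmoothness

end

open QuotientSmoothness

/-! ### Descent of formal smoothness along adjunction of a root -/

section FormallySmoothDescent

open Polynomial

/-! Smoothness is local on `Y`, so let `X = Spec A` and `Y = Spec B`, where `B` is the ring of
invariants of the automorphism `σ` of `A` given by a generator of `G`. The ideal `I` of the fixed
locus is generated by the elements `σ a - a` (`ker_fixedLocusι_ideal`). As `p` is invertible in `k`,
a cyclotomic extension contains a primitive `p`-th root of unity `ω`, and smoothness descends from
it (`smooth_invariants`). Then `A` is the sum of the eigenspaces of `σ`, and `I` is generated by the
eigenvectors of nontrivial eigenvalue. Near a point `I` is also generated by one nonzerodivisor, so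
by Nakayama a single eigenvector `t` generates it (`exists_eigenvector_generator`). Division by `t`
lowers the weight of an eigenvector, so locally on `Y` one has `A = B[T]/(T^p - s)` with `s = t^p`
(`formallySmooth_localization`). Formal smoothness of this ring gives that of `B`: adjoin a `p`-th
root to the target of a lifting problem for `B`, solve the enlarged problem, and take the constant
coefficient, which is multiplicative on `B` (`formallySmooth_of_adjoinRoot`).

For existence, homogeneous prime avoidance puts every orbit in an affine open; intersecting its
translates gives stable affine opens covering `X`. The spectra of their invariant rings glue,
because an inclusion of stable affine opens induces an open immersion of quotients
(`isOpenImmersion_specMap_invariantSectionsMap`). The result is a quotient by a criterion local on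
`Y` (`IsQuotient.of_iSup_eq_top`). -/

theorem map_mem_of_mem_map {C C' : Type*} [CommRing C] [CommRing C'] [Algebra C C']
    (l : C' →ₗ[C] C) {N : Ideal C} {x : C'} (hx : x ∈ N.map (algebraMap C C')) : l x ∈ N := by
  have hx' : x ∈ (N • ⊤ : Submodule C C') := by rw [Ideal.smul_top_eq_map]; exact hx
  refine Submodule.smul_induction_on hx' (fun n hn y _ => ?_) fun x y hx hy => ?_
  · rw [map_smul]; exact N.mul_mem_right _ hn
  · rw [map_add]; exact N.add_mem hx hy

/-- If a `C`-linear functional `l` on a `C`-algebra `C'` sends `1` to `1` and `φ : B → C'` takes values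
in `C + N C'` with `N² = 0`, then `l ∘ φ` is multiplicative. -/
theorem map_mul_of_mem_add_of_sq_eq_bot {B C C' : Type*} [CommRing B] [CommRing C] [CommRing C']
    [Algebra C C'] (l : C' →ₗ[C] C) (hl : l 1 = 1) {N : Ideal C} (hN : N ^ 2 = ⊥)
    (φ : B →+* C')
    (hφ : ∀ b, ∃ c : C, φ b - algebraMap C C' c ∈ N.map (algebraMap C C')) (b b' : B) :
    l (φ (b * b')) = l (φ b) * l (φ b') := by
  obtain ⟨c, hc⟩ := hφ b
  obtain ⟨c', hc'⟩ := hφ b'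
  set n := φ b - algebraMap C C' c with hn
  set n' := φ b' - algebraMap C C' c' with hn'
  have e : φ b = algebraMap C C' c + n := by rw [hn]; ring
  have e' : φ b' = algebraMap C C' c' + n' := by rw [hn']; ring
  -- The functional preserves `N`, so the second-order terms vanish both before and after applying
  -- `l`.
  have h0 : n * n' = 0 := by
    have : n * n' ∈ (N ^ 2).map (algebraMap C C') := by
      rw [Ideal.map_pow, pow_two]; exact Ideal.mul_mem_mul hc hc'
    rwa [hN, Ideal.map_bot, Ideal.mem_bot] at this
  have h1 : l n * l n' = 0 := by
    have : l n * l n' ∈ N ^ 2 := by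
      rw [pow_two]; exact Ideal.mul_mem_mul (map_mem_of_mem_map l hc) (map_mem_of_mem_map l hc')
    rwa [hN, Ideal.mem_bot] at this
  have hla : ∀ c, l (algebraMap C C' c) = c := fun c => by
    rw [Algebra.algebraMap_eq_smul_one, map_smul, hl, smul_eq_mul, mul_one]
  have hlm : ∀ c x, l (algebraMap C C' c * x) = c * l x := fun c x => by
    rw [← Algebra.smul_def, map_smul, smul_eq_mul]
  have : φ (b * b') = algebraMap C C' (c * c') + algebraMap C C' c * n' + algebraMap C C' c' * n := by
    rw [map_mul, e, e', map_mul]; linear_combination h0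
  rw [this, e, e']
  simp only [map_add, hla, hlm]
  linear_combination -h1

/-- Formal smoothness descends along the adjunction of a `p`-th root. -/
theorem formallySmooth_of_adjoinRoot {k B : Type*} [CommRing k] [CommRing B] [Algebra k B]
    {p : ℕ} (hp : 0 < p) (s : B) [Algebra.FormallySmooth k (AdjoinRoot (X ^ p - C s))] :
    Algebra.FormallySmooth k B := by
  refine Algebra.FormallySmooth.of_comp_surjective fun R _ _ N hN f => ?_
  -- With `r` lifting `f s`, sending root to root extends `f` to a map `g` into `R' ⧸ N'`, which
  -- lifts to `R'` by hypothesis.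
  obtain ⟨r, hr⟩ := Ideal.Quotient.mk_surjective (f s)
  let R' := AdjoinRoot (X ^ p - C r)
  let N' : Ideal R' := N.map (algebraMap R R')
  have hN' : N' ^ 2 = ⊥ := by rw [← Ideal.map_pow, hN, Ideal.map_bot]
  let j : R ⧸ N →ₐ[k] R' ⧸ N' := Ideal.quotientMapₐ N' (IsScalarTower.toAlgHom k R R') Ideal.le_comap_map
  have hj : ∀ x, j (Ideal.Quotient.mk N x) = Ideal.Quotient.mk N' (algebraMap R R' x) := fun x => rfl
  let g : AdjoinRoot (X ^ p - C s) →ₐ[k] R' ⧸ N' :=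
    AdjoinRoot.liftAlgHom _ (j.comp f) (Ideal.Quotient.mk N' (AdjoinRoot.root _)) (by
      rw [eval₂_sub, eval₂_pow, eval₂_X, eval₂_C]
      change _ - j (f s) = 0
      rw [← hr, hj, ← map_pow, ← map_sub]
      have : AdjoinRoot.mk (X ^ p - C r) (X ^ p - C r) = 0 := AdjoinRoot.mk_self
      rw [map_sub, map_pow, AdjoinRoot.mk_X, AdjoinRoot.mk_C] at this
      change Ideal.Quotient.mk N' (AdjoinRoot.root (X ^ p - C r) ^ p - AdjoinRoot.of _ r) = 0
      rw [this, map_zero])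
  obtain ⟨φ, hφ⟩ := Algebra.FormallySmooth.comp_surjective k _ N' hN' g
  have hφ' : ∀ x, Ideal.Quotient.mk N' (φ x) = g x := fun x => DFunLike.congr_fun hφ x
  have hm : (X ^ p - C r).Monic := monic_X_pow_sub_C r hp.ne'
  -- The constant coefficient in the basis of powers of the root. It is not multiplicative on `R'`,
  -- only on the image of `B`, which lies in `R + N'`.
  let l : R' →ₗ[R] R := (lcoeff R 0).comp (AdjoinRoot.modByMonicHom hm)
  have hl : l 1 = 1 := by
    rcases subsingleton_or_nontrivial R with hR | hR
    · exact Subsingleton.elim _ _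
    change ((AdjoinRoot.modByMonicHom hm) 1).coeff 0 = 1
    rw [← map_one (AdjoinRoot.mk _), AdjoinRoot.modByMonicHom_mk, (modByMonic_eq_self_iff hm).2]
    · simp
    · rw [degree_one, degree_X_pow_sub_C hp]; exact_mod_cast hp
  let ψ : B →+* R' := φ.toRingHom.comp (algebraMap B _)
  have hψ : ∀ b r, Ideal.Quotient.mk N r = f b → ψ b - algebraMap R R' r ∈ N' := by
    intro b r hr
    rw [← Ideal.Quotient.eq_zero_iff_mem, map_sub, ← hj, hr]
    change Ideal.Quotient.mk N' (φ (algebraMap B _ b)) - _ = 0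
    rw [hφ', sub_eq_zero]
    exact AdjoinRoot.liftAlgHom_of ..
  have hmul := map_mul_of_mem_add_of_sq_eq_bot l hl hN ψ fun b => by
    obtain ⟨r, hr⟩ := Ideal.Quotient.mk_surjective (f b)
    exact ⟨r, hψ b r hr⟩
  have hla : ∀ r, l (algebraMap R R' r) = r := fun r => by
    rw [Algebra.algebraMap_eq_smul_one, map_smul, hl, smul_eq_mul, mul_one]
  refine ⟨AlgHom.ofLinearMap
    { toFun := fun b => l (ψ b)
      map_add' := fun b b' => by rw [map_add, map_add]
      map_smul' := fun c b => ?_ } ?_ hmul, ?_⟩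
  · change l (φ (algebraMap B _ (c • b))) = c • l (φ (algebraMap B _ b))
    rw [Algebra.smul_def, map_mul, ← IsScalarTower.algebraMap_apply, ← Algebra.smul_def, map_smul,
      LinearMap.map_smul_of_tower]
  · change l (ψ 1) = 1
    rw [map_one, hl]
  · ext b
    obtain ⟨r, hr⟩ := Ideal.Quotient.mk_surjective (f b)
    change Ideal.Quotient.mk N (l (ψ b)) = f b
    rw [← hr, Ideal.Quotient.eq]
    have := map_mem_of_mem_map l (hψ b r hr)
    rwa [map_sub, hla] at this

end FormallySmoothDescent

/-! ### Eigenvectors of an automorphism of prime order -/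

section CyclicAction

/-- The element `t` of the ideal `I` becomes a nonzerodivisor generating `I` after inverting the
elements of `S`. -/
structure Ideal.IsRegularGeneratorAway {A : Type*} [CommRing A] (I : Ideal A) (S : Submonoid A)
    (t : A) : Prop where
  mem : t ∈ I
  dvd : ∀ a ∈ I, ∃ s ∈ S, t ∣ s * a
  regular : ∀ a, t * a = 0 → ∃ s ∈ S, s * a = 0

/-- The ideal generated by the elements `σ a - a`. -/
def movedIdeal {A : Type*} [CommRing A] (σ : A → A) : Ideal A :=
  Ideal.span (Set.range fun a => σ a - a)

variable {k A : Type*} [Field k] [CommRing A] [Algebra k A] {σ : A →ₐ[k] A} {p : ℕ} {ω : k}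

theorem sub_mem_movedIdeal (a : A) : σ a - a ∈ movedIdeal σ :=
  Ideal.subset_span ⟨a, rfl⟩

theorem coprime_of_mem_range (hp : p.Prime) {i : ℕ} (hi : i ∈ Finset.range p) (h : i ≠ 0) :
    i.Coprime p :=
  (hp.coprime_iff_not_dvd.2 fun hd =>
    (Finset.mem_range.1 hi).not_ge (Nat.le_of_dvd (Nat.pos_of_ne_zero h) hd)).symm

/-- Discrete Fourier transform: the projector to weight `j` averages `ω⁻¹ ^ (i * j) • σ^[i] a` over
`i`. Summed over `j`, only `i = 0` survives. -/
theorem exists_eq_sum_eigenvectors (hp : p.Prime) (hpk : (p : k) ≠ 0) (hσ : ∀ a, σ^[p] a = a)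
    (hω : IsPrimitiveRoot ω p) (a : A) :
    ∃ c : ℕ → A, (∀ j, σ (c j) = ω ^ j • c j) ∧ a = ∑ j ∈ Finset.range p, c j := by
  have hω0 : ω ≠ 0 := hω.ne_zero hp.ne_zero
  refine ⟨fun j => (p : k)⁻¹ • ∑ i ∈ Finset.range p, (ω⁻¹ ^ (i * j)) • σ^[i] a, fun j => ?_, ?_⟩
  · rw [map_smul, smul_comm, map_sum]
    congr 1
    have h1 : ∑ i ∈ Finset.range p, (ω⁻¹ ^ (i * j)) • σ^[i] a
        = ∑ i ∈ Finset.range p, (ω⁻¹ ^ ((i + 1) * j)) • σ^[i + 1] a := by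
      have := Finset.sum_range_succ (fun i => (ω⁻¹ ^ (i * j)) • σ^[i] a) p
      rw [Finset.sum_range_succ'] at this
      have e : ω⁻¹ ^ (p * j) = 1 := by rw [pow_mul, inv_pow, hω.pow_eq_one, inv_one, one_pow]
      rw [hσ, e, zero_mul, pow_zero, Function.iterate_zero_apply] at this
      exact (add_right_cancel this).symm
    rw [h1, Finset.smul_sum]
    refine Finset.sum_congr rfl fun i _ => ?_
    have e : ω ^ j * ω⁻¹ ^ ((i + 1) * j) = ω⁻¹ ^ (i * j) := by
      rw [add_mul, one_mul, pow_add, mul_left_comm, ← mul_pow, mul_inv_cancel₀ hω0, one_pow, mul_one]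
    rw [map_smul, smul_smul, e, Function.iterate_succ_apply']
  · rw [← Finset.smul_sum, Finset.sum_comm]
    have h1 : ∀ i ∈ Finset.range p, ∑ j ∈ Finset.range p, (ω⁻¹ ^ (i * j)) • σ^[i] a
        = if i = 0 then (p : k) • a else 0 := by
      intro i hi
      rw [← Finset.sum_smul]
      split_ifs with h
      · simp [h]
      · have h2 : IsPrimitiveRoot (ω⁻¹ ^ i) p := by
          exact hω.inv.pow_of_coprime i (coprime_of_mem_range hp hi h)
        simp_rw [pow_mul]
        rw [h2.geom_sum_eq_zero hp.one_lt, zero_smul]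
    rw [Finset.sum_congr rfl h1, Finset.sum_ite_eq' , if_pos (Finset.mem_range.2 hp.pos), smul_smul,
      inv_mul_cancel₀ hpk, one_smul]

theorem eq_zero_of_sum_eigenvectors_eq_zero (hω : IsPrimitiveRoot ω p) {x : ℕ → A}
    (hx : ∀ j < p, σ (x j) = ω ^ j • x j) (h0 : ∑ j ∈ Finset.range p, x j = 0) :
    ∀ j < p, x j = 0 := by
  have hind := (Module.End.eigenspaces_iSupIndep (σ.toLinearMap : Module.End k A)).comp
    (f := fun j : Fin p => ω ^ (j : ℕ)) (fun i j h => Fin.ext (hω.pow_inj i.2 j.2 h))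
  rw [iSupIndep_iff_finsetSum_eq_zero_imp_eq_zero] at hind
  intro j hj
  refine hind Finset.univ (fun i => x i) (fun i _ => ?_) ?_ ⟨j, hj⟩ (Finset.mem_univ _)
  · exact Module.End.mem_eigenspace_iff.2 (hx i i.2)
  · rw [← h0, Finset.sum_range]

/-- Here `σ a - a = (c - 1) • a`, and `c - 1` is a unit of `k`. -/
theorem mem_movedIdeal_of_eigenvector {c : k} (hc : c ≠ 1) {a : A} (ha : σ a = c • a) :
    a ∈ movedIdeal σ := by
  have h := sub_mem_movedIdeal (σ := σ) a
  have hc' : c - 1 ≠ 0 := sub_ne_zero.2 hc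
  rw [ha, ← one_smul k a, smul_smul, mul_one, ← sub_smul] at h
  rw [← one_smul k a, ← inv_mul_cancel₀ hc', ← smul_smul, Algebra.smul_def]
  exact Ideal.mul_mem_left _ _ h

/-- The moved ideal is generated by the eigenvectors with nontrivial eigenvalue. -/
theorem movedIdeal_le_span_eigenvectors (hp : p.Prime) (hpk : (p : k) ≠ 0)
    (hσ : ∀ a, σ^[p] a = a) (hω : IsPrimitiveRoot ω p) :
    movedIdeal σ ≤ Ideal.span {a | ∃ η : k, IsPrimitiveRoot η p ∧ σ a = η • a} := by
  refine Ideal.span_le.2 ?_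
  rintro _ ⟨a, rfl⟩
  obtain ⟨c, hc, rfl⟩ := exists_eq_sum_eigenvectors hp hpk hσ hω a
  change σ _ - _ ∈ _
  rw [map_sum, ← Finset.sum_sub_distrib]
  refine Ideal.sum_mem _ fun j hj => ?_
  rw [hc]
  -- The invariant component cancels; for `0 < j < p` the eigenvalue `ω ^ j` is again primitive
  -- because `p` is prime.
  rcases eq_or_ne j 0 with rfl | h
  · simp
  · have : c j ∈ Ideal.span {a | ∃ η : k, IsPrimitiveRoot η p ∧ σ a = η • a} := by
      refine Ideal.subset_span ⟨ω ^ j, hω.pow_of_coprime j (coprime_of_mem_range hp hj h), hc j⟩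
    refine Ideal.sub_mem _ ?_ this
    rw [Algebra.smul_def]
    exact Ideal.mul_mem_left _ _ this

variable {B : Type*} [CommRing B] [Algebra B A]

/-- If the moved ideal is generated by a nonzerodivisor at the prime `q`, then it is generated by
an eigenvector, which is a nonzerodivisor, over the prime of the ring of invariants below `q`. -/
theorem exists_eigenvector_generator (hp : p.Prime) (hpk : (p : k) ≠ 0) (hσ : ∀ a, σ^[p] a = a)
    (hω : IsPrimitiveRoot ω p) (hfix : ∀ a, σ a = a → a ∈ Set.range (algebraMap B A))
    (q : Ideal A) [q.IsPrime] {t₀ : A}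
    (ht₀ : (movedIdeal σ).IsRegularGeneratorAway q.primeCompl t₀) :
    ∃ (η : k) (t : A), IsPrimitiveRoot η p ∧ σ t = η • t ∧
      (movedIdeal σ).IsRegularGeneratorAway
        (Algebra.algebraMapSubmonoid A (q.comap (algebraMap B A)).primeCompl) t := by
  by_cases hIq : movedIdeal σ ≤ q
  · -- `h` in the complement of `q` divides an invariant in the complement of `q`
    have hinv : ∀ h ∈ q.primeCompl, ∃ s ∈ Algebra.algebraMapSubmonoid A
        (q.comap (algebraMap B A)).primeCompl, h ∣ s := by
      intro h hh
      -- `σ` is the identity modulo the moved ideal, hence modulo `q`, so all conjugates of `h` stay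
      -- outside `q`. Their product, the norm of `h`, is the desired invariant.
      have h1 : ∀ j, σ^[j] h ∉ q := by
        intro j
        induction j with
        | zero => exact hh
        | succ j ih =>
          intro hj
          rw [Function.iterate_succ_apply'] at hj
          exact ih ((Submodule.sub_mem_iff_right q hj).1 (hIq (sub_mem_movedIdeal _)))
      obtain ⟨b, hb⟩ := hfix (∏ j ∈ Finset.range p, σ^[j] h) (by
        rw [map_prod]
        simp_rw [← Function.iterate_succ_apply' σ]
        obtain ⟨m, rfl⟩ := Nat.exists_eq_succ_of_ne_zero hp.ne_zero
        rw [Finset.prod_range_succ, Finset.prod_range_succ', hσ, Function.iterate_zero_apply])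
      refine ⟨_, ⟨b, ?_, rfl⟩, ?_⟩
      · change algebraMap B A b ∉ q
        rw [hb, Ideal.IsPrime.prod_mem_iff]
        push Not
        exact fun j _ => h1 j
      · rw [hb]
        exact Finset.dvd_prod_of_mem (fun j => σ^[j] h) (Finset.mem_range.2 hp.pos)
    -- Nakayama by hand. If each eigenvector generator were locally `t₀` times an element of `q`, so
    -- would be every element of the ideal, including `t₀`. Then `t₀` would be killed by some `s - d
    -- ∉ q`, against its regularity.
    have h0 : ∃ a, (∃ η : k, IsPrimitiveRoot η p ∧ σ a = η • a) ∧ ∃ d ∉ q, ∃ s ∉ q, s * a = t₀ * d := by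
      by_contra! hcon
      have key : ∀ a ∈ movedIdeal σ, ∃ s ∉ q, ∃ d ∈ q, s * a = t₀ * d := by
        intro a ha
        replace ha := movedIdeal_le_span_eigenvectors hp hpk hσ hω ha
        rw [Ideal.span] at ha
        induction ha using Submodule.span_induction with
        | mem a ha =>
          obtain ⟨η, hη, ha'⟩ := ha
          obtain ⟨s, hs, d, hd⟩ := ht₀.dvd a (mem_movedIdeal_of_eigenvector (hη.ne_one hp.one_lt) ha')
          by_cases hdq : d ∈ q
          · exact ⟨s, hs, d, hdq, hd⟩
          · exact absurd hd (hcon a ⟨η, hη, ha'⟩ d hdq s hs)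
        | zero => exact ⟨1, q.primeCompl.one_mem, 0, q.zero_mem, by simp⟩
        | add x y _ _ hx hy =>
          obtain ⟨s, hs, d, hd, e⟩ := hx
          obtain ⟨s', hs', d', hd', e'⟩ := hy
          exact ⟨s * s', q.primeCompl.mul_mem hs hs', s' * d + s * d',
            q.add_mem (q.mul_mem_left _ hd) (q.mul_mem_left _ hd'), by linear_combination s' * e + s * e'⟩
        | smul c x _ hx =>
          obtain ⟨s, hs, d, hd, e⟩ := hx
          exact ⟨s, hs, c * d, q.mul_mem_left _ hd, by rw [smul_eq_mul]; linear_combination c * e⟩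
      obtain ⟨s, hs, d, hd, e⟩ := key t₀ ht₀.mem
      obtain ⟨s', hs', e'⟩ := ht₀.regular (s - d) (by linear_combination e)
      have : s' * (s - d) ∈ q := by rw [e']; exact q.zero_mem
      rcases Ideal.IsPrime.mem_or_mem ‹_› this with h | h
      · exact hs' h
      · exact hs ((Submodule.sub_mem_iff_left q hd).1 h)
    obtain ⟨t, ⟨η, hη, ht⟩, d, hd, s, hs, e⟩ := h0
    -- By `e`, `t` and `t₀` differ by a unit at `q`, so `t` inherits both properties; `hinv`
    -- replaces denominators outside `q` by invariant ones.
    refine ⟨η, t, hη, ht, mem_movedIdeal_of_eigenvector (hη.ne_one hp.one_lt) ht, fun a ha => ?_,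
      fun a ha => ?_⟩
    · obtain ⟨h, hh, c, hc⟩ := ht₀.dvd a ha
      obtain ⟨f, hf, w, rfl⟩ := hinv (d * h) (q.primeCompl.mul_mem hd hh)
      exact ⟨_, hf, s * c * w, by linear_combination w * d * hc - w * c * e⟩
    · obtain ⟨h, hh, hc⟩ := ht₀.regular (d * a) (by linear_combination s * ha - a * e)
      obtain ⟨f, hf, w, rfl⟩ := hinv (d * h) (q.primeCompl.mul_mem hd hh)
      exact ⟨_, hf, by linear_combination w * hc⟩
  -- Away from the fixed locus some eigenvector `t` lies outside `q`. Then `t ^ p` is an invariant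
  -- outside `q`, so `t` becomes a unit and generates trivially.
  · obtain ⟨t, ⟨η, hη, ht⟩, htq⟩ : ∃ t, (∃ η : k, IsPrimitiveRoot η p ∧ σ t = η • t) ∧ t ∉ q := by
      by_contra! h
      exact hIq ((movedIdeal_le_span_eigenvectors hp hpk hσ hω).trans (Ideal.span_le.2 h))
    obtain ⟨b, hb⟩ := hfix (t ^ p) (by rw [map_pow, ht, smul_pow, hη.pow_eq_one, one_smul])
    have hbq : algebraMap B A b ∈ Algebra.algebraMapSubmonoid A (q.comap (algebraMap B A)).primeCompl := by
      refine ⟨b, fun h => htq ?_, rfl⟩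
      rw [SetLike.mem_coe, Ideal.mem_comap, hb] at h
      exact Ideal.IsPrime.mem_of_pow_mem ‹_› _ h
    have hd : t ∣ algebraMap B A b := hb ▸ dvd_pow_self t hp.ne_zero
    refine ⟨η, t, hη, ht, mem_movedIdeal_of_eigenvector (hη.ne_one hp.one_lt) ht,
      fun a _ => ⟨_, hbq, hd.mul_right a⟩, fun a ha => ⟨_, hbq, ?_⟩⟩
    obtain ⟨w, hw⟩ := hd
    rw [hw]; linear_combination w * ha

variable [Algebra k B] [IsScalarTower k B A]

/-- If `t` is an eigenvector generating the moved ideal after inverting a submonoid `M` of the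
ring of invariants `B`, then formal smoothness of `A` implies formal smoothness of `M⁻¹ B`, as
`M⁻¹ A = M⁻¹ B[t]` with `t ^ p ∈ B`. -/
theorem formallySmooth_localization (hp : p.Prime) (hpk : (p : k) ≠ 0) (hσ : ∀ a, σ^[p] a = a)
    (hinj : Function.Injective (algebraMap B A))
    (hfix : ∀ a, σ a = a ↔ a ∈ Set.range (algebraMap B A)) [Algebra.FormallySmooth k A]
    (M : Submonoid B) (hω : IsPrimitiveRoot ω p) {t : A} (ht : σ t = ω • t)
    (hM : (movedIdeal σ).IsRegularGeneratorAway (Algebra.algebraMapSubmonoid A M) t) :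
    Algebra.FormallySmooth k (Localization M) := by
  let N := Algebra.algebraMapSubmonoid A M
  obtain ⟨s, hs⟩ := (hfix (t ^ p)).1 (by rw [map_pow, ht, smul_pow, hω.pow_eq_one, one_smul])
  have hpow : ∀ (j : ℕ) (a : A), t ^ j * a = 0 → ∃ m ∈ N, m * a = 0 := by
    intro j
    induction j with
    | zero => exact fun a ha => ⟨1, N.one_mem, by simpa using ha⟩
    | succ j ih =>
      intro a ha
      obtain ⟨m, hm, h⟩ := hM.regular (t ^ j * a) (by rw [← ha]; ring)
      obtain ⟨m', hm', h'⟩ := ih (m * a) (by rw [← h]; ring)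
      exact ⟨m' * m, N.mul_mem hm' hm, by rw [← h']; ring⟩
  have hfixN : ∀ m ∈ N, σ m = m := by
    rintro _ ⟨b, _, rfl⟩
    exact (hfix _).2 ⟨b, rfl⟩
  -- Up to denominators, weight `j` is `B * t ^ j`: for positive weight the eigenvector lies in the
  -- moved ideal, hence is divisible by `t`, and the quotient has weight one less.
  have hdiv : ∀ j < p, ∀ a : A, σ a = ω ^ j • a →
      ∃ m ∈ N, ∃ b : B, m * a = algebraMap B A b * t ^ j := by
    intro j
    induction j with
    | zero =>
      intro _ a ha
      obtain ⟨b, rfl⟩ := (hfix a).1 (by simpa using ha)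
      exact ⟨1, N.one_mem, b, by simp⟩
    | succ j ih =>
      intro hj a ha
      obtain ⟨m, hm, c, hc⟩ := hM.dvd a (mem_movedIdeal_of_eigenvector
        (hω.pow_ne_one_of_pos_of_lt j.succ_ne_zero hj) ha)
      -- Apply `σ` to `m * a = t * c` and cancel one factor `ω`.
      have h1 : t * (σ c - ω ^ j • c) = 0 := by
        have h2 := congrArg σ hc
        rw [map_mul, map_mul, hfixN m hm, ha, ht, mul_smul_comm, hc, smul_mul_assoc, pow_succ',
          mul_smul] at h2
        have h3 := congrArg (fun x => ω⁻¹ • x) h2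
        simp only [smul_smul ω⁻¹ ω, inv_mul_cancel₀ (hω.ne_zero hp.ne_zero), one_smul] at h3
        rw [mul_sub, ← h3, mul_smul_comm, sub_self]
      obtain ⟨m', hm', h'⟩ := hM.regular _ h1
      obtain ⟨m'', hm'', b, hb⟩ := ih (by omega) (m' * c) (by
        rw [map_mul, hfixN m' hm', ← mul_smul_comm]; linear_combination h')
      refine ⟨m'' * m' * m, N.mul_mem (N.mul_mem hm'' hm') hm, b, ?_⟩
      linear_combination m'' * m' * hc + t * hb
  let BM := Localization M
  let AM := Localization N
  have : Algebra.FormallySmooth k AM := by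
    have : Algebra.FormallySmooth A AM := .of_isLocalization N
    exact .comp k A AM
  let tM : AM := algebraMap A AM t
  have hsM : tM ^ p = algebraMap BM AM (algebraMap B BM s) := by
    rw [← IsScalarTower.algebraMap_apply B BM AM, IsScalarTower.algebraMap_apply B A AM, hs, map_pow]
  have : IsScalarTower k BM AM := .of_algebraMap_eq fun x => by
    rw [IsScalarTower.algebraMap_apply k A AM, IsScalarTower.algebraMap_apply k B A,
      ← IsScalarTower.algebraMap_apply B A AM, IsScalarTower.algebraMap_apply B BM AM,
      ← IsScalarTower.algebraMap_apply k B BM]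
  have hmap : ∀ b, algebraMap BM AM (algebraMap B BM b) = algebraMap A AM (algebraMap B A b) :=
    fun b => by rw [← IsScalarTower.algebraMap_apply B BM AM, IsScalarTower.algebraMap_apply B A AM]
  open Polynomial in
  have hbij : Function.Bijective (AdjoinRoot.liftAlgHom (X ^ p - C (algebraMap B BM s))
      (Algebra.ofId BM AM) tM (by simp [hsM])) := by
    refine ⟨?_, ?_⟩
    -- Injectivity: represent the element by a polynomial of degree less than `p` and clear
    -- denominators. The terms `b j * t ^ j` have distinct eigenvalues, so each vanishes separately,
    -- and `t ^ j` can be cancelled by `hpow`.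
    · rw [injective_iff_map_eq_zero]
      intro x hx
      have hmon : (X ^ p - C (algebraMap B BM s)).Monic := monic_X_pow_sub_C _ hp.ne_zero
      obtain ⟨P, hPx, hP⟩ : ∃ P : BM[X], AdjoinRoot.mk _ P = x ∧ P.degree < p := by
        obtain ⟨Q, rfl⟩ := AdjoinRoot.mk_surjective x
        refine ⟨_, AdjoinRoot.mk_leftInverse hmon _, ?_⟩
        rw [AdjoinRoot.modByMonicHom_mk]
        rcases subsingleton_or_nontrivial BM with h | h
        · rw [Subsingleton.elim (Q %ₘ _) 0, degree_zero]
          exact WithBot.bot_lt_coe p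
        · exact (degree_modByMonic_lt _ hmon).trans_eq (degree_X_pow_sub_C hp.pos _)
      obtain ⟨m, hm⟩ := IsLocalization.exist_integer_multiples M (Finset.range p) P.coeff
      have hm' : ∀ j : ℕ, ∃ b : B, j < p → algebraMap B BM b = algebraMap B BM m * P.coeff j := by
        intro j
        by_cases hj : j < p
        · obtain ⟨b, hb⟩ := hm j (Finset.mem_range.2 hj)
          exact ⟨b, fun _ => by rw [hb, Algebra.smul_def]⟩
        · exact ⟨0, fun h => absurd h hj⟩
      choose b hb using hm'
      have hsum : algebraMap A AM (∑ j ∈ Finset.range p, algebraMap B A (b j) * t ^ j) = 0 := by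
        rw [← hPx] at hx
        change eval₂ _ _ P = 0 at hx
        rw [eval₂_eq_sum_range' _ (n := p)] at hx
        · rw [map_sum, ← mul_zero (algebraMap BM AM (algebraMap B BM m)), ← hx, Finset.mul_sum]
          refine Finset.sum_congr rfl fun j hj => ?_
          rw [map_mul, ← hmap, hb j (Finset.mem_range.1 hj), map_mul, map_pow, mul_assoc]
          rfl
        · rcases eq_or_ne P 0 with rfl | h0
          · simpa using hp.pos
          · exact (natDegree_lt_iff_degree_lt h0).2 hP
      obtain ⟨⟨n, hn⟩, hn'⟩ := (IsLocalization.map_eq_zero_iff N AM _).1 hsum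
      dsimp only at hn'
      rw [Finset.mul_sum] at hn'
      have hz := eq_zero_of_sum_eigenvectors_eq_zero (σ := σ) hω (fun j _ => by
        rw [map_mul, map_mul, map_pow, ht, hfixN n hn, (hfix _).2 ⟨b j, rfl⟩, _root_.smul_pow,
          mul_smul_comm, mul_smul_comm]) hn'
      have hP0 : P = 0 := by
        ext j
        rw [coeff_zero]
        by_cases hj : j < p
        · obtain ⟨m', hm', h'⟩ := hpow j (n * algebraMap B A (b j)) (by
            rw [← hz j hj]; ring)
          obtain ⟨c, hc, hc'⟩ := N.mul_mem hm' hn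
          have hbz : algebraMap B BM (b j) = 0 := by
            refine (IsLocalization.map_eq_zero_iff M BM _).2 ⟨⟨c, hc⟩, hinj ?_⟩
            rw [map_mul, map_zero]
            change algebraMap B A c * _ = 0
            rw [show algebraMap B A c = m' * n from hc', mul_assoc, h']
          have hu := IsLocalization.map_units BM m
          rw [hb j hj] at hbz
          exact hu.mul_right_eq_zero.1 hbz
        · exact coeff_eq_zero_of_degree_lt (hP.trans_le (by exact_mod_cast not_lt.1 hj))
      rw [← hPx, hP0, map_zero]
    -- Surjectivity: each eigencomponent is reached by `hdiv`, and the denominators in `N` are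
    -- inverted already in `BM`.
    · set Φ := AdjoinRoot.liftAlgHom (X ^ p - C (algebraMap B BM s))
        (Algebra.ofId BM AM) tM (by simp [hsM])
      have hinv : ∀ m ∈ N, ∃ u : BM, algebraMap BM AM u * algebraMap A AM m = 1 := by
        rintro _ ⟨b, hb, rfl⟩
        refine ⟨IsLocalization.mk' BM 1 ⟨b, hb⟩, ?_⟩
        change _ * algebraMap A AM (algebraMap B A b) = 1
        rw [← hmap, ← map_mul]
        have := IsLocalization.mk'_spec BM 1 ⟨b, hb⟩
        dsimp only at this
        rw [this, map_one, map_one]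
      have hdescend : ∀ m ∈ N, ∀ y : AM, algebraMap A AM m * y ∈ Φ.range → y ∈ Φ.range := by
        intro m hm y hy
        obtain ⟨u, hu⟩ := hinv m hm
        have : y = u • (algebraMap A AM m * y) := by
          rw [Algebra.smul_def, ← mul_assoc, hu, one_mul]
        rw [this]
        exact Subalgebra.smul_mem _ hy u
      have hroot : tM ∈ Φ.range := ⟨AdjoinRoot.root _, AdjoinRoot.liftAlgHom_root ..⟩
      have hA : ∀ a, algebraMap A AM a ∈ Φ.range := by
        intro a
        obtain ⟨c, hc, rfl⟩ := exists_eq_sum_eigenvectors hp hpk hσ hω a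
        rw [map_sum]
        refine Subalgebra.sum_mem _ fun j hj => ?_
        obtain ⟨m, hm, b, hb⟩ := hdiv j (Finset.mem_range.1 hj) (c j) (hc j)
        refine hdescend m hm _ ?_
        rw [← map_mul, hb, map_mul, map_pow, ← hmap]
        exact Subalgebra.mul_mem _ (Subalgebra.algebraMap_mem _ _) (Subalgebra.pow_mem _ hroot j)
      intro y
      obtain ⟨⟨a, n⟩, hn⟩ := IsLocalization.surj N y
      refine hdescend n n.2 y ?_
      rw [mul_comm, hn]
      exact hA a
  let e := AlgEquiv.ofBijective _ hbij
  open Polynomial in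
  have : Algebra.FormallySmooth k (AdjoinRoot (X ^ p - C (algebraMap B BM s))) :=
    .of_equiv (e.symm.restrictScalars k)
  exact formallySmooth_of_adjoinRoot hp.pos (algebraMap B BM s)

end CyclicAction

/-! ### Smoothness of the ring of invariants -/

section SmoothInvariants

open TensorProduct

/-- The `p`-th power of an eigenvector is invariant, so `A` is integral, hence finite, over `B`, and
the Artin–Tate lemma makes `B` of finite type over `k`. Smoothness is then checked at each prime of
`B`, using a prime `q` of `A` above it. -/
theorem smooth_invariants_of_isPrimitiveRoot {k A B : Type*} [Field k] [CommRing A] [Algebra k A]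
    {σ : A →ₐ[k] A} {p : ℕ} {ω : k} [CommRing B] [Algebra B A] [Algebra k B] [IsScalarTower k B A]
    (hp : p.Prime) (hpk : (p : k) ≠ 0) (hσ : ∀ a, σ^[p] a = a)
    (hinj : Function.Injective (algebraMap B A))
    (hfix : ∀ a, σ a = a ↔ a ∈ Set.range (algebraMap B A)) [Algebra.Smooth k A]
    (hω : IsPrimitiveRoot ω p)
    (H : ∀ (q : Ideal A) [q.IsPrime], ∃ t, (movedIdeal σ).IsRegularGeneratorAway q.primeCompl t) :
    Algebra.Smooth k B := by
  have hint : Algebra.IsIntegral B A := by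
    refine ⟨fun a => ?_⟩
    obtain ⟨c, hc, rfl⟩ := exists_eq_sum_eigenvectors hp hpk hσ hω a
    refine IsIntegral.sum _ fun j _ => ?_
    obtain ⟨b, hb⟩ := (hfix (c j ^ p)).1 (by
      rw [map_pow, hc, smul_pow, ← pow_mul, mul_comm, pow_mul, hω.pow_eq_one, one_pow, one_smul])
    exact IsIntegral.of_pow hp.pos (hb ▸ isIntegral_algebraMap)
  have hftA : Algebra.FiniteType k A := inferInstance
  have : Algebra.FiniteType B A := .of_restrictScalars_finiteType k B A
  have hfin : Module.Finite B A := Algebra.IsIntegral.finite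
  have hft : Algebra.FiniteType k B :=
    ⟨fg_of_fg_of_fg k B A hftA.out hfin.fg_top hinj⟩
  have : Algebra.FinitePresentation k B := Algebra.FinitePresentation.of_finiteType.1 hft
  refine ⟨Algebra.smoothLocus_eq_univ_iff.1 (Set.eq_univ_of_forall fun b => ?_), this⟩
  obtain ⟨q, hq, hqb⟩ : ∃ q : Ideal A, q.IsPrime ∧ q.comap (algebraMap B A) = b.asIdeal := by
    obtain ⟨q, -, hq, h⟩ := Ideal.exists_ideal_over_prime_of_isIntegral b.asIdeal (⊥ : Ideal A) (by
      rw [Ideal.comap_bot_of_injective _ hinj]; exact bot_le)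
    exact ⟨q, hq, h⟩
  obtain ⟨t₀, ht₀⟩ := H q
  obtain ⟨η, t, hη, ht, htM⟩ := exists_eigenvector_generator (B := B) hp hpk hσ hω
    (fun a => (hfix a).1) q ht₀
  have := formallySmooth_localization hp hpk hσ hinj hfix _ hη ht htM
  rcases b with ⟨b, hb⟩
  subst hqb
  exact this

/-- Let `σ` be an automorphism of prime order `p`, invertible in `k`, of a smooth `k`-algebra `A`.
If the ideal generated by the elements `σ a - a` is locally generated by a nonzerodivisor, then
the ring of invariants is smooth over `k`. -/
theorem smooth_invariants {k A B : Type*} [Field k] [CommRing A] [Algebra k A]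
    {σ : A →ₐ[k] A} {p : ℕ} [CommRing B] [Algebra B A] [Algebra k B] [IsScalarTower k B A]
    (hp : p.Prime) (hpk : (p : k) ≠ 0) (hσ : ∀ a, σ^[p] a = a)
    (hinj : Function.Injective (algebraMap B A))
    (hfix : ∀ a, σ a = a ↔ a ∈ Set.range (algebraMap B A)) [Algebra.Smooth k A]
    (H : ∀ (q : Ideal A) [q.IsPrime], ∃ t, (movedIdeal σ).IsRegularGeneratorAway q.primeCompl t) :
    Algebra.Smooth k B := by
  have : NeZero p := ⟨hp.ne_zero⟩
  have : NeZero (p : k) := ⟨hpk⟩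
  let K := CyclotomicField p k
  have hpK : (p : K) ≠ 0 := by
    rw [← map_natCast (algebraMap k K), ne_eq, map_eq_zero]; exact hpk
  have : NeZero (p : K) := ⟨hpK⟩
  have hω := IsCyclotomicExtension.zeta_spec p k K
  let φ : K ⊗[k] B →ₐ[K] K ⊗[k] A :=
    Algebra.TensorProduct.map (AlgHom.id K K) (IsScalarTower.toAlgHom k B A)
  let τ : K ⊗[k] A →ₐ[K] K ⊗[k] A := Algebra.TensorProduct.map (AlgHom.id K K) σ
  algebraize [φ.toRingHom]
  have : IsScalarTower K (K ⊗[k] B) (K ⊗[k] A) := .of_algebraMap_eq fun x => (φ.commutes x).symm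
  have : Algebra.Smooth K (K ⊗[k] B) := by
    refine smooth_invariants_of_isPrimitiveRoot (σ := τ) hp hpK ?_ ?_ ?_ hω ?_
    · have h : ∀ (i : ℕ) (c : K) (a : A), τ^[i] (c ⊗ₜ a) = c ⊗ₜ σ^[i] a := by
        intro i c
        induction i with
        | zero => exact fun a => rfl
        | succ i ih =>
          intro a
          rw [Function.iterate_succ_apply, Function.iterate_succ_apply, ← ih]
          rfl
      intro x
      induction x with
      | zero => exact Function.iterate_fixed (map_zero τ) p
      | tmul c a => rw [h, hσ]
      | add x y hx hy => rw [iterate_map_add, hx, hy]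
    · exact Module.Flat.lTensor_preserves_injective_linearMap (M := K)
        (IsScalarTower.toAlgHom k B A).toLinearMap hinj
    · intro x
      -- The invariants are the kernel of `σ - id`, whose formation commutes with the flat base
      -- change to `K`.
      have hex : Function.Exact (IsScalarTower.toAlgHom k B A).toLinearMap
          (σ.toLinearMap - (LinearMap.id : A →ₗ[k] A)) := by
        intro a
        simpa [sub_eq_zero] using hfix a
      refine Iff.trans ?_ (Module.Flat.lTensor_exact K hex x)
      rw [LinearMap.lTensor_sub, LinearMap.lTensor_id, LinearMap.sub_apply, sub_eq_zero]
      exact Iff.rfl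
    · intro q hq
      let ι : A →ₐ[k] K ⊗[k] A := Algebra.TensorProduct.includeRight
      -- The moved ideal of `τ` is the extension of that of `σ`, so a local generator at the
      -- contraction of `q` serves at `q`.
      obtain ⟨t, ht⟩ := H (q.comap ι)
      have hτ : ∀ a, τ (ι a) = ι (σ a) := fun a => by simp [τ, ι]
      refine ⟨ι t, ?_, fun x hx => ?_, fun x hx => ?_⟩
      · have hle : (movedIdeal σ).map ι ≤ movedIdeal τ := by
          rw [movedIdeal, Ideal.map_span, Ideal.span_le]
          rintro _ ⟨_, ⟨a, rfl⟩, rfl⟩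
          change ι (σ a - a) ∈ _
          rw [map_sub, ← hτ]
          exact sub_mem_movedIdeal _
        exact hle (Ideal.mem_map_of_mem ι ht.mem)
      · have hle : movedIdeal τ ≤ (movedIdeal σ).map ι := by
          refine Ideal.span_le.2 ?_
          rintro _ ⟨x, rfl⟩
          change τ x - x ∈ (movedIdeal σ).map ι
          induction x with
          | zero => simp
          | tmul c a =>
            have : τ (c ⊗ₜ a) - c ⊗ₜ a = (c ⊗ₜ 1) * ι (σ a - a) := by
              simp [τ, ι, TensorProduct.tmul_sub, mul_sub]
            rw [this]
            exact Ideal.mul_mem_left _ _ (Ideal.mem_map_of_mem ι (sub_mem_movedIdeal _))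
          | add x y hx hy =>
            rw [map_add, add_sub_add_comm]
            exact Ideal.add_mem _ hx hy
        replace hx := hle hx
        rw [Ideal.map] at hx
        induction hx using Submodule.span_induction with
        | mem x hx =>
          obtain ⟨a, ha, rfl⟩ := hx
          obtain ⟨s, hs, h⟩ := ht.dvd a ha
          exact ⟨ι s, hs, by simpa using map_dvd ι h⟩
        | zero => exact ⟨1, q.primeCompl.one_mem, by simp⟩
        | add x y _ _ hx hy =>
          obtain ⟨s, hs, h⟩ := hx
          obtain ⟨s', hs', h'⟩ := hy
          refine ⟨s * s', q.primeCompl.mul_mem hs hs', ?_⟩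
          rw [show s * s' * (x + y) = s' * (s * x) + s * (s' * y) by ring]
          exact dvd_add (h.mul_left _) (h'.mul_left _)
        | smul c x _ hx =>
          obtain ⟨s, hs, h⟩ := hx
          refine ⟨s, hs, ?_⟩
          rw [smul_eq_mul, mul_left_comm]
          exact h.mul_left _
      -- For regularity, `A ⊗ K` is free over `A`: `t` kills every coordinate of `x`, and the
      -- product of the finitely many denominators on the support kills `x`.
      · let e := Algebra.TensorProduct.comm k K A
        let bas := Algebra.TensorProduct.basis A (Module.Free.chooseBasis k K)
        have he : ∀ (a : A) (x : K ⊗[k] A), e (ι a * x) = a • e x := fun a x => by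
          rw [map_mul, Algebra.smul_def]
          simp [e, ι]
        have h0 : ∀ i, t * bas.repr (e x) i = 0 := fun i => by
          rw [← smul_eq_mul, ← Finsupp.smul_apply, ← map_smul, ← he, hx]
          simp
        choose s hs hs0 using fun i => ht.regular _ (h0 i)
        let u := ∏ i ∈ (bas.repr (e x)).support, s i
        refine ⟨ι u, Submonoid.prod_mem (q.comap ι).primeCompl fun i _ => hs i, e.injective ?_⟩
        rw [he, map_zero]
        refine bas.repr.injective (Finsupp.ext fun i => ?_)
        rw [map_smul, Finsupp.smul_apply, map_zero, Finsupp.zero_apply, smul_eq_mul]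
        by_cases hi : i ∈ (bas.repr (e x)).support
        · obtain ⟨w, hw⟩ := Finset.dvd_prod_of_mem s hi
          rw [show u = s i * w from hw, mul_right_comm, hs0, zero_mul]
        · rw [Finsupp.notMem_support_iff.1 hi, mul_zero]
  exact Algebra.Smooth.of_smooth_tensorProduct_of_faithfullyFlat K

end SmoothInvariants

/-! ### Homogeneous prime avoidance -/

section HomogeneousPrimeAvoidance

variable {R A : Type*} [CommRing R] [CommRing A] [Algebra R A] (𝒜 : ℕ → Submodule R A)
  [GradedAlgebra 𝒜]

variable {𝒜} in
-- If all components of `a` were in `J`, so would be `a`. The final equation lets one exclude degree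
-- `0` when `a` is in the irrelevant ideal.
theorem HomogeneousIdeal.exists_homogeneous_notMem {I : HomogeneousIdeal 𝒜} {J : Ideal A} {a : A}
    (ha : a ∈ I) (haJ : a ∉ J) : ∃ i, ∃ b ∈ 𝒜 i, b ∈ I ∧ b ∉ J ∧ b = GradedRing.proj 𝒜 i a := by
  classical
  by_contra! h
  refine haJ ?_
  rw [← DirectSum.sum_support_decompose 𝒜 a]
  refine J.sum_mem fun i _ => ?_
  by_contra hi
  exact h i _ (SetLike.coe_mem _) (I.isHomogeneous i ha) hi rfl

/-- Homogeneous prime avoidance: a homogeneous ideal not contained in any of finitely many relevant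
homogeneous primes has a homogeneous element of positive degree outside all of them. -/
theorem ProjectiveSpectrum.exists_homogeneous_mem_forall_notMem (I : HomogeneousIdeal 𝒜)
    (T : Finset (ProjectiveSpectrum 𝒜)) (hT : ∀ x ∈ T, ¬ I ≤ x.asHomogeneousIdeal) :
    ∃ n, 0 < n ∧ ∃ f ∈ 𝒜 n, f ∈ I ∧ ∀ x ∈ T, f ∉ x.asHomogeneousIdeal := by
  classical
  induction T using Finset.strongInduction with
  | H T ih =>
    rcases T.eq_empty_or_nonempty with rfl | hne
    · exact ⟨1, one_pos, 0, Submodule.zero_mem _, I.toIdeal.zero_mem, by simp⟩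
    -- Minimality of `x` ensures that no other prime of `T` is contained in it.
    obtain ⟨x, hx, hmin⟩ := T.exists_minimal hne
    obtain ⟨n, hn, f, hfn, hfI, hf⟩ := ih (T.erase x) (Finset.erase_ssubset hx)
      fun y hy => hT y (Finset.mem_of_mem_erase hy)
    by_cases hfx : f ∈ x.asHomogeneousIdeal
    swap
    · refine ⟨n, hn, f, hfn, hfI, fun y hy => ?_⟩
      rcases eq_or_ne y x with rfl | h
      · exact hfx
      · exact hf y (Finset.mem_erase.2 ⟨h, hy⟩)
    -- a homogeneous element of `I` and of the other primes, outside `x`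
    have hy : ∀ y ∈ T.erase x, ∃ i, ∃ b ∈ 𝒜 i, b ∈ y.asHomogeneousIdeal ∧ b ∉ x.asHomogeneousIdeal := by
      intro y hy
      have hle : ¬ y.asHomogeneousIdeal ≤ x.asHomogeneousIdeal := fun h =>
        (Finset.mem_erase.1 hy).1 (le_antisymm h (hmin (Finset.mem_of_mem_erase hy) h))
      obtain ⟨a, ha, hax⟩ := SetLike.not_le_iff_exists.1 hle
      obtain ⟨i, b, hb, h1, h2, -⟩ := HomogeneousIdeal.exists_homogeneous_notMem ha
        (J := x.asHomogeneousIdeal.toIdeal) hax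
      exact ⟨i, b, hb, h1, h2⟩
    choose! d g hgd hgy hgx using hy
    obtain ⟨a, ha, hax⟩ := SetLike.not_le_iff_exists.1 (hT x hx)
    obtain ⟨i, b, hb, hbI, hbx, -⟩ := HomogeneousIdeal.exists_homogeneous_notMem ha
      (J := x.asHomogeneousIdeal.toIdeal) hax
    -- Relevance of `x` supplies a factor `e ∉ x` of positive degree, so that `w` has positive
    -- degree too.
    obtain ⟨c, hc, hcx⟩ := SetLike.not_le_iff_exists.1 x.not_irrelevant_le
    obtain ⟨j, e, he, -, hex, hec⟩ := HomogeneousIdeal.exists_homogeneous_notMem hc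
      (J := x.asHomogeneousIdeal.toIdeal) hcx
    have hj : 0 < j := by
      refine Nat.pos_of_ne_zero ?_
      rintro rfl
      rw [HomogeneousIdeal.mem_irrelevant_iff] at hc
      exact hex (by rw [hec, hc]; exact Ideal.zero_mem _)
    set w := b * e * ∏ y ∈ T.erase x, g y with hw
    have hwd : w ∈ 𝒜 (i + j + ∑ y ∈ T.erase x, d y) :=
      SetLike.mul_mem_graded (SetLike.mul_mem_graded hb he) (SetLike.prod_mem_graded 𝒜 _ _ hgd)
    set m := i + j + ∑ y ∈ T.erase x, d y
    have hm : 0 < m := by omega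
    have hwI : w ∈ I.toIdeal := by
      rw [hw, mul_assoc]; exact Ideal.mul_mem_right _ _ hbI
    have hwx : w ∉ x.asHomogeneousIdeal.toIdeal := by
      intro h
      rcases x.isPrime.mem_or_mem h with h | h
      · rcases x.isPrime.mem_or_mem h with h | h
        · exact hbx h
        · exact hex h
      · obtain ⟨y, hy, h⟩ := (Ideal.IsPrime.prod_mem_iff).1 h
        exact hgx y hy h
    have hwy : ∀ y ∈ T.erase x, w ∈ y.asHomogeneousIdeal.toIdeal := fun y hy =>
      Ideal.mul_mem_left _ _ (Ideal.mem_of_dvd _ (Finset.dvd_prod_of_mem g hy) (hgy y hy))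
    -- The exponents equalise the degrees. Each prime of `T` contains exactly one summand: `f ^ m`
    -- at `x`, `w ^ n` at the others.
    refine ⟨n * m, Nat.mul_pos hn hm, f ^ m + w ^ n, Submodule.add_mem _ ?_ ?_, ?_, fun y hy => ?_⟩
    · simpa [mul_comm] using SetLike.pow_mem_graded m hfn
    · simpa using SetLike.pow_mem_graded n hwd
    · exact I.toIdeal.add_mem (I.toIdeal.pow_mem_of_mem hfI _ hm) (I.toIdeal.pow_mem_of_mem hwI _ hn)
    · rcases eq_or_ne y x with rfl | h
      · exact fun h => hwx (y.isPrime.mem_of_pow_mem _ ((Ideal.add_mem_iff_right _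
          (Ideal.pow_mem_of_mem _ hfx _ hm)).1 h))
      · have hyT := Finset.mem_erase.2 ⟨h, hy⟩
        exact fun h => hf y hyT (y.isPrime.mem_of_pow_mem _ ((Ideal.add_mem_iff_left _
          (Ideal.pow_mem_of_mem _ (hwy y hyT) _ hn)).1 h))

end HomogeneousPrimeAvoidance

/-! ### Finite sets of points lie in affine open sets -/

namespace QuotientSmoothness

attribute [local instance] MvPolynomial.gradedAlgebra

/-- An immersion is a closed immersion into the open set `i.coborderRange`. Prime avoidance gives a
form `f` vanishing on the complement of that set but at no point of `i '' T`; the preimage of the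
affine `D₊(f)` is then affine. -/
theorem exists_isAffineOpen_proj {R A : Type u} [CommRing R] [CommRing A] [Algebra R A]
    (𝒜 : ℕ → Submodule R A) [GradedAlgebra 𝒜] {X : Scheme.{u}} (i : X ⟶ Proj 𝒜) [IsImmersion i]
    (T : Set X) (hT : T.Finite) : ∃ U : X.Opens, IsAffineOpen U ∧ T ⊆ U := by
  classical
  let C : Set (ProjectiveSpectrum 𝒜) := (i.coborderRange : Set (Proj 𝒜))ᶜ
  have hC : IsClosed C := i.coborderRange.isOpen.isClosed_compl
  have hz := ProjectiveSpectrum.zeroLocus_vanishingIdeal_eq_closure 𝒜 C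
  rw [hC.closure_eq] at hz
  let T' : Finset (ProjectiveSpectrum 𝒜) := hT.toFinset.image fun x => (i x : Proj 𝒜)
  obtain ⟨n, hn, f, hfn, hfI, hf⟩ := ProjectiveSpectrum.exists_homogeneous_mem_forall_notMem 𝒜
    (ProjectiveSpectrum.vanishingIdeal C) T' (by
      intro y hy hle
      obtain ⟨x, -, rfl⟩ := Finset.mem_image.1 hy
      have h1 : (i x : ProjectiveSpectrum 𝒜) ∈ C := by
        rw [← hz]; exact hle
      refine h1 ?_
      exact subset_coborder ⟨x, rfl⟩)
  have hle : Proj.basicOpen 𝒜 f ≤ i.coborderRange := by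
    intro y hy
    by_contra hyC
    have : (y : ProjectiveSpectrum 𝒜) ∈ C := hyC
    rw [← hz] at this
    exact hy (this hfI)
  have haff : IsAffineOpen (i.coborderRange.ι ⁻¹ᵁ Proj.basicOpen 𝒜 f) :=
    (Proj.isAffineOpen_basicOpen 𝒜 f hfn hn).preimage_of_isOpenImmersion _ (by simpa using hle)
  refine ⟨_, haff.preimage i.liftCoborder, fun x hx => ?_⟩
  rw [← Scheme.Hom.comp_preimage, i.liftCoborder_ι]
  exact hf _ (Finset.mem_image.2 ⟨x, hT.mem_toFinset.2 hx, rfl⟩)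

end QuotientSmoothness

/-! ### Invariants and localization -/

/-- Invariants of a finite group commute with localization at an invariant element. -/
theorem exists_invariant_lift {G A A' : Type*} [Finite G] [CommRing A] [CommRing A']
    (φ : A' →+* A) (θ' : G → A' →+* A') (θ : G → A →+* A) (hφ : ∀ g a, φ (θ' g a) = θ g (φ a))
    {f : A'} (hf : ∀ g, θ' g f = f) (hsurj : ∀ y, ∃ (n : ℕ) (y' : A'), φ y' = φ f ^ n * y)
    (hker : ∀ y', φ y' = 0 → ∃ n : ℕ, f ^ n * y' = 0) {y : A} (hy : ∀ g, θ g y = y) :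
    ∃ (n : ℕ) (y' : A'), (∀ g, θ' g y' = y') ∧ φ y' = φ f ^ n * y := by
  cases nonempty_fintype G
  obtain ⟨n, y', h⟩ := hsurj y
  have h1 : ∀ g, ∃ m : ℕ, f ^ m * (θ' g y' - y') = 0 := fun g => hker _ (by
    rw [map_sub, hφ, h, map_mul, map_pow, ← hφ, hf, hy, sub_self])
  choose m hm using h1
  -- As `G` is finite, one power of `f` kills all the defects `θ' g y' - y'` at once.
  refine ⟨(∑ g, m g) + n, f ^ (∑ g, m g) * y', fun g => ?_, ?_⟩
  · obtain ⟨c, hc⟩ := pow_dvd_pow f (Finset.single_le_sum (f := m) (fun _ _ => Nat.zero_le _)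
      (Finset.mem_univ g))
    rw [← sub_eq_zero, map_mul, map_pow, hf, ← mul_sub, hc, mul_right_comm, hm, zero_mul]
  · rw [map_mul, h, map_pow, pow_add, mul_assoc]

namespace QuotientSmoothness

section Sections

variable {X : Scheme.{u}} {U D : X.Opens}

/-- Stated with an equation for `D`, so as to apply to sets such as the preimage of a basic open
set. -/
theorem IsAffineOpen.exists_eq_pow_mul (hU : IsAffineOpen U) (f : Γ(X, U)) (hle : D ≤ U)
    (hD : D = X.basicOpen f) (y : Γ(X, D)) : ∃ (n : ℕ) (s : Γ(X, U)),
      X.presheaf.map (homOfLE hle).op s = X.presheaf.map (homOfLE hle).op f ^ n * y := by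
  subst hD
  have := hU.isLocalization_basicOpen f
  obtain ⟨n, a, ha⟩ := IsLocalization.Away.surj f y
  exact ⟨n, a, by rw [mul_comm]; exact ha.symm⟩

theorem IsAffineOpen.exists_pow_mul_eq_zero (hU : IsAffineOpen U) (f : Γ(X, U)) (hle : D ≤ U)
    (hD : D = X.basicOpen f) (s : Γ(X, U)) (hs : X.presheaf.map (homOfLE hle).op s = 0) :
    ∃ n : ℕ, f ^ n * s = 0 := by
  subst hD
  have := hU.isLocalization_basicOpen f
  obtain ⟨⟨_, n, rfl⟩, h⟩ := (IsLocalization.map_eq_zero_iff (Submonoid.powers f)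
    Γ(X, X.basicOpen f) s).1 hs
  exact ⟨n, h⟩

theorem isUnit_map_of_eq_basicOpen (f : Γ(X, U)) (hle : D ≤ U) (hD : D = X.basicOpen f) :
    IsUnit (X.presheaf.map (homOfLE hle).op f) := by
  subst hD
  exact RingedSpace.isUnit_res_basicOpen _ f

end Sections

/-! ### The action on sections over stable open sets -/

section Action

variable {S : Scheme.{u}} {G : Type v} [Group G] {X : Over S} (ρ : G →* Aut X)

theorem act_one : act ρ 1 = 𝟙 X := by
  rw [act, map_one]; rfl

theorem act_mul (g h : G) : act ρ (g * h) = act ρ h ≫ act ρ g := by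
  rw [act, map_mul]; rfl

instance (g : G) : IsIso (act ρ g) := Iso.isIso_hom (ρ g)

instance (g : G) : IsIso (act ρ g).left := inferInstanceAs (IsIso ((Over.forget S).map (act ρ g)))

/-- An open set is stable if it is mapped to itself by the group. -/
def IsStable (W : X.left.Opens) : Prop := ∀ g, W ≤ (act ρ g).left ⁻¹ᵁ W

variable {ρ} {W : X.left.Opens} (hW : IsStable ρ W)

/-- The pullback of sections on a stable open set along `x ↦ g x`. -/
def pullbackSection (g : G) : Γ(X.left, W) →+* Γ(X.left, W) :=
  ((act ρ g).left.appLE W W (hW g)).hom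

theorem pullbackSection_one (a : Γ(X.left, W)) : pullbackSection hW 1 a = a := by
  -- The morphism is generalized because the containment proof depends on it.
  have : ∀ (f : X ⟶ X) (h : W ≤ f.left ⁻¹ᵁ W), f = 𝟙 X → f.left.appLE W W h a = a := by
    rintro f h rfl
    change (𝟙 X.left : X.left ⟶ X.left).appLE W W h a = a
    rw [Scheme.Hom.appLE, Scheme.Hom.id_app]
    exact congr($(X.left.presheaf.map_id _) a)
  exact this _ _ (act_one ρ)

theorem pullbackSection_mul (g h : G) (a : Γ(X.left, W)) :
    pullbackSection hW (g * h) a = pullbackSection hW h (pullbackSection hW g a) := by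
  have : ∀ (f : X ⟶ X) (hf : W ≤ f.left ⁻¹ᵁ W), f = act ρ h ≫ act ρ g →
      f.left.appLE W W hf = (act ρ g).left.appLE W W (hW g) ≫ (act ρ h).left.appLE W W (hW h) := by
    rintro f hf rfl
    rw [Scheme.Hom.appLE_comp_appLE]
    rfl
  exact congr($(this _ (hW (g * h)) (act_mul ρ g h)) a)

theorem map_pullbackSection {W' : X.left.Opens} (hW' : IsStable ρ W') (hle : W' ≤ W) (g : G)
    (a : Γ(X.left, W)) : X.left.presheaf.map (homOfLE hle).op (pullbackSection hW g a) =
      pullbackSection hW' g (X.left.presheaf.map (homOfLE hle).op a) := by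
  have : (act ρ g).left.appLE W W (hW g) ≫ X.left.presheaf.map (homOfLE hle).op =
      X.left.presheaf.map (homOfLE hle).op ≫ (act ρ g).left.appLE W' W' (hW' g) := by
    rw [Scheme.Hom.appLE_map, Scheme.Hom.map_appLE]
  exact congr($this a)

/-- The action of `G` on the sections over a stable open set. -/
@[reducible] def sectionsAction : MulSemiringAction G Γ(X.left, W) where
  -- Pullback reverses products; the inverse turns it into a left action.
  smul g a := pullbackSection hW g⁻¹ a
  one_smul a := by
    change pullbackSection hW 1⁻¹ a = a
    rw [inv_one, pullbackSection_one]
  mul_smul g h a := by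
    change pullbackSection hW (g * h)⁻¹ a = pullbackSection hW g⁻¹ (pullbackSection hW h⁻¹ a)
    rw [mul_inv_rev, pullbackSection_mul]
  smul_zero g := map_zero (pullbackSection hW g⁻¹)
  smul_add g := map_add (pullbackSection hW g⁻¹)
  smul_one g := map_one (pullbackSection hW g⁻¹)
  smul_mul g := map_mul (pullbackSection hW g⁻¹)

variable {B : CommRingCat.{u}} (φ : B ⟶ Γ(X.left, W))

theorem isInvariant_of_range_eq_invariants
    (hφ : Set.range φ = {a | ∀ g, pullbackSection hW g a = a}) :
    letI := sectionsAction hW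
    letI := φ.hom.toAlgebra
    Algebra.IsInvariant B Γ(X.left, W) G :=
  letI := sectionsAction hW
  letI := φ.hom.toAlgebra
  ⟨fun b hb => by
    have : b ∈ Set.range φ := by
      rw [hφ]
      intro g
      have := hb g⁻¹
      change pullbackSection hW g⁻¹⁻¹ b = b at this
      rwa [inv_inv] at this
    exact this⟩

variable [Finite G]

theorem isIntegral_of_range_eq_invariants
    (hφ : Set.range φ = {a | ∀ g, pullbackSection hW g a = a}) : φ.hom.IsIntegral := by
  let := sectionsAction hW
  let := φ.hom.toAlgebra
  have := isInvariant_of_range_eq_invariants hW φ hφ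
  exact (Algebra.IsInvariant.isIntegral B Γ(X.left, W) G).isIntegral

/-- A finite group acts transitively on the primes over a given prime of its ring of invariants, so
the fibres are orbits. -/
theorem exists_act_eq_of_specMap_eq
    (hφ : Set.range φ = {a | ∀ g, pullbackSection hW g a = a}) (hWa : IsAffineOpen W) (P Q : Spec Γ(X.left, W))
    (hPQ : Spec.map φ P = Spec.map φ Q) :
    ∃ g, (act ρ g).left (hWa.fromSpec P) = hWa.fromSpec Q := by
  let := sectionsAction hW
  let := φ.hom.toAlgebra
  have := isInvariant_of_range_eq_invariants hW φ hφ
  have : SMulCommClass G B Γ(X.left, W) := ⟨fun g b a => by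
    have hb : φ b ∈ {a | ∀ g, pullbackSection hW g a = a} := hφ ▸ ⟨b, rfl⟩
    change pullbackSection hW g⁻¹ (φ b * a) = φ b * pullbackSection hW g⁻¹ a
    rw [map_mul, hb]⟩
  have : P.asIdeal.IsPrime := PrimeSpectrum.isPrime P
  have : Q.asIdeal.IsPrime := PrimeSpectrum.isPrime Q
  obtain ⟨g, hg⟩ := Algebra.IsInvariant.exists_smul_of_under_eq B Γ(X.left, W) G
    P.asIdeal Q.asIdeal (congrArg PrimeSpectrum.asIdeal hPQ)
  have hQ : Q = Spec.map ((act ρ g).left.appLE W W (hW g)) P := by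
    refine PrimeSpectrum.ext ?_
    rw [hg]
    ext a
    rw [Ideal.mem_pointwise_smul_iff_inv_smul_mem]
    change pullbackSection hW g⁻¹⁻¹ a ∈ P.asIdeal ↔ pullbackSection hW g a ∈ P.asIdeal
    rw [inv_inv]
  refine ⟨g, ?_⟩
  rw [hQ, ← Scheme.Hom.comp_apply, ← Scheme.Hom.comp_apply, IsAffineOpen.SpecMap_appLE_fromSpec]

end Action

/-! ### A local criterion for quotients -/

section Criterion

variable {S : Scheme.{u}} {G : Type v} [Group G] {X Y : Over S} {ρ : G →* Aut X} {π : X ⟶ Y}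

theorem preimage_isStable (h : ∀ g, act ρ g ≫ π = π) (V : Y.left.Opens) :
    IsStable ρ (π.left ⁻¹ᵁ V) :=
  fun g => preimage_le_preimage h g V

theorem pullbackSection_app (h : ∀ g, act ρ g ≫ π = π) (V : Y.left.Opens) (g : G)
    (b : Γ(Y.left, V)) :
    pullbackSection (preimage_isStable h V) g (π.left.app V b) = π.left.app V b := by
  have : ∀ (f : X.left ⟶ Y.left) (e : π.left ⁻¹ᵁ V ≤ f ⁻¹ᵁ V), f = π.left →
      f.appLE V (π.left ⁻¹ᵁ V) e = π.left.app V := by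
    rintro f e rfl
    exact Scheme.Hom.appLE_eq_app _
  have h1 := this ((act ρ g).left ≫ π.left) (by
    rw [Scheme.Hom.comp_preimage]; exact preimage_le_preimage h g V)
    (by rw [← Over.comp_left, h g])
  rw [Scheme.Hom.comp_appLE] at h1
  exact congr($h1 b)

/-- The sections of `𝒪_Y` over `V` are the invariant sections of `𝒪_X` over the preimage of `V`. -/
def SectionsEqInvariants (h : ∀ g, act ρ g ≫ π = π) (V : Y.left.Opens) : Prop :=
  Function.Injective (π.left.app V) ∧
    ∀ a, (∀ g, pullbackSection (preimage_isStable h V) g a = a) → a ∈ Set.range (π.left.app V)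

theorem SectionsEqInvariants.range_eq {h : ∀ g, act ρ g ≫ π = π} {V : Y.left.Opens}
    (H : SectionsEqInvariants h V) :
    Set.range (π.left.app V) = {a | ∀ g, pullbackSection (preimage_isStable h V) g a = a} := by
  refine Set.Subset.antisymm ?_ fun a ha => H.2 a ha
  rintro _ ⟨b, rfl⟩ g
  exact pullbackSection_app h V g b

theorem map_app_apply {X Y : Scheme.{u}} (f : X ⟶ Y) {V V' : Y.Opens} (hle : V' ≤ V)
    (b : Γ(Y, V)) : X.presheaf.map (homOfLE (f.preimage_mono hle)).op (f.app V b) =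
      f.app V' (Y.presheaf.map (homOfLE hle).op b) :=
  congr($(f.naturality (homOfLE hle).op) b).symm

variable [Finite G]

/-- Both sections and invariants over the basic open set are localizations at `f`; invariance
survives by `exists_invariant_lift`. -/
theorem SectionsEqInvariants.basicOpen {h : ∀ g, act ρ g ≫ π = π} [IsAffineHom π.left]
    {V : Y.left.Opens} (H : SectionsEqInvariants h V) (hV : IsAffineOpen V) (f : Γ(Y.left, V)) :
    SectionsEqInvariants h (Y.left.basicOpen f) := by
  have hle := Y.left.basicOpen_le f
  have hU : IsAffineOpen (π.left ⁻¹ᵁ V) := hV.preimage π.left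
  have hD : π.left ⁻¹ᵁ Y.left.basicOpen f = X.left.basicOpen (π.left.app V f) :=
    Scheme.preimage_basicOpen _ _
  have hfu := isUnit_map_of_eq_basicOpen f hle rfl
  refine ⟨?_, fun a ha => ?_⟩
  · rw [injective_iff_map_eq_zero]
    intro b hb
    obtain ⟨n, s, hs⟩ := IsAffineOpen.exists_eq_pow_mul hV f hle rfl b
    obtain ⟨m, hm⟩ := IsAffineOpen.exists_pow_mul_eq_zero hU (π.left.app V f)
      (π.left.preimage_mono hle) hD (π.left.app V s) (by
        rw [map_app_apply _ hle, hs, map_mul, hb, mul_zero])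
    rw [← map_pow, ← map_mul, map_eq_zero_iff _ H.1] at hm
    have := congrArg (Y.left.presheaf.map (homOfLE hle).op) hm
    rw [map_mul, map_pow, hs, map_zero] at this
    exact (hfu.pow n).mul_right_eq_zero.1 ((hfu.pow m).mul_right_eq_zero.1 this)
  · obtain ⟨n, s, hs, e⟩ := exists_invariant_lift
      (X.left.presheaf.map (homOfLE (π.left.preimage_mono hle)).op).hom
      (pullbackSection (preimage_isStable h V))
      (pullbackSection (preimage_isStable h (Y.left.basicOpen f)))
      (fun g a => map_pullbackSection _ _ _ g a) (f := π.left.app V f)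
      (fun g => pullbackSection_app h V g f)
      (IsAffineOpen.exists_eq_pow_mul hU _ (π.left.preimage_mono hle) hD)
      (IsAffineOpen.exists_pow_mul_eq_zero hU _ (π.left.preimage_mono hle) hD) ha
    obtain ⟨b, rfl⟩ := H.2 s hs
    obtain ⟨u, hu⟩ := hfu.pow n
    refine ⟨↑u⁻¹ * Y.left.presheaf.map (homOfLE hle).op b, ?_⟩
    have e' : π.left.app _ (Y.left.presheaf.map (homOfLE hle).op b) = π.left.app _ (u : Γ(Y.left, _)) * a := by
      rw [← map_app_apply, hu, map_pow, ← map_app_apply]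
      exact e
    rw [map_mul, e', ← mul_assoc, ← map_mul, Units.inv_mul, map_one, one_mul]

/-- The property passes to basic open sets, hence holds on a basis of `Y`, and then everywhere by
the sheaf axioms. Injectivity is needed on all open sets before gluing, to compare local preimages
on overlaps. -/
theorem SectionsEqInvariants.of_iSup_eq_top {h : ∀ g, act ρ g ≫ π = π} [IsAffineHom π.left]
    {ι : Type*} (V : ι → Y.left.Opens) (hVa : ∀ i, IsAffineOpen (V i)) (hV : ⨆ i, V i = ⊤)
    (H : ∀ i, SectionsEqInvariants h (V i)) (W : Y.left.Opens) : SectionsEqInvariants h W := by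
  have hloc : ∀ (W : Y.left.Opens) (y : W), ∃ D : Y.left.Opens, y.1 ∈ D ∧ D ≤ W ∧
      SectionsEqInvariants h D := by
    intro W y
    have : y.1 ∈ ⨆ i, V i := hV ▸ trivial
    obtain ⟨i, hi⟩ := TopologicalSpace.Opens.mem_iSup.1 this
    obtain ⟨f, hf, hyf⟩ := (hVa i).exists_basicOpen_le y hi
    exact ⟨_, hyf, hf, (H i).basicOpen (hVa i) f⟩
  have hinj : ∀ W : Y.left.Opens, Function.Injective (π.left.app W) := by
    intro W s t hst
    choose D hyD hDW hD using hloc W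
    refine Y.left.sheaf.eq_of_locally_eq' D W (fun y => homOfLE (hDW y))
      (fun y hy => TopologicalSpace.Opens.mem_iSup.2 ⟨⟨y, hy⟩, hyD ⟨y, hy⟩⟩) s t fun y => ?_
    refine (hD y).1 ?_
    change π.left.app (D y) (Y.left.presheaf.map (homOfLE (hDW y)).op s) =
      π.left.app (D y) (Y.left.presheaf.map (homOfLE (hDW y)).op t)
    rw [← map_app_apply, ← map_app_apply, hst]
  refine ⟨hinj W, fun a ha => ?_⟩
  choose D hyD hDW hD using hloc W
  have hcov : W ≤ ⨆ y, D y := fun y hy =>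
    TopologicalSpace.Opens.mem_iSup.2 ⟨⟨y, hy⟩, hyD ⟨y, hy⟩⟩
  have hb : ∀ y, ∃ b, π.left.app (D y) b =
      X.left.presheaf.map (homOfLE (π.left.preimage_mono (hDW y))).op a := fun y =>
    (hD y).2 _ fun g => by rw [← map_pullbackSection (preimage_isStable h W), ha]
  choose b hb using hb
  obtain ⟨s, hs⟩ : ∃ s : Γ(Y.left, W), ∀ y, Y.left.presheaf.map (homOfLE (hDW y)).op s = b y := by
    refine (Y.left.sheaf.existsUnique_gluing' D W (fun y => homOfLE (hDW y)) hcov b ?_).exists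
    intro y z
    refine hinj _ ?_
    change π.left.app _ (Y.left.presheaf.map (homOfLE inf_le_left).op (b y)) =
      π.left.app _ (Y.left.presheaf.map (homOfLE inf_le_right).op (b z))
    rw [← map_app_apply, ← map_app_apply, hb, hb, ← ConcreteCategory.comp_apply,
      ← ConcreteCategory.comp_apply, ← Functor.map_comp, ← Functor.map_comp]
    rfl
  refine ⟨s, X.left.sheaf.eq_of_locally_eq' (fun y => π.left ⁻¹ᵁ D y) (π.left ⁻¹ᵁ W)
    (fun y => homOfLE (π.left.preimage_mono (hDW y))) (fun x hx => ?_) _ _ fun y => ?_⟩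
  · exact TopologicalSpace.Opens.mem_iSup.2 ⟨⟨π.left x, hx⟩, hyD ⟨π.left x, hx⟩⟩
  · change X.left.presheaf.map (homOfLE _).op (π.left.app W s) =
      X.left.presheaf.map (homOfLE _).op a
    rw [map_app_apply _ (hDW y), hs, hb]

/-- A criterion for `Y` to be the quotient `X/G`, local on `Y`. -/
theorem IsQuotient.of_iSup_eq_top (h : ∀ g, act ρ g ≫ π = π) [IsAffineHom π.left]
    {ι : Type*} (V : ι → Y.left.Opens) (hVa : ∀ i, IsAffineOpen (V i)) (hV : ⨆ i, V i = ⊤)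
    (H : ∀ i, SectionsEqInvariants h (V i)) : IsQuotient ρ π := by
  have HW := SectionsEqInvariants.of_iSup_eq_top V hVa hV H
  have hint : IsIntegralHom π.left :=
    ⟨fun U _ => isIntegral_of_range_eq_invariants _ _ (HW U).range_eq⟩
  have hcov : ∀ y : Y.left, ∃ i, y ∈ V i := fun y => by
    have : y ∈ ⨆ i, V i := hV ▸ trivial
    exact TopologicalSpace.Opens.mem_iSup.1 this
  have hspec : ∀ i, Spec.map (π.left.app (V i)) ≫ (hVa i).fromSpec =
      ((hVa i).preimage π.left).fromSpec ≫ π.left := fun i => by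
    rw [Scheme.Hom.app_eq_appLE, IsAffineOpen.SpecMap_appLE_fromSpec]
  have hsurj : Function.Surjective π.left := by
    intro y
    obtain ⟨i, hi⟩ := hcov y
    rw [← SetLike.mem_coe, ← (hVa i).range_fromSpec] at hi
    obtain ⟨b, rfl⟩ := hi
    obtain ⟨P, rfl⟩ : ∃ P, Spec.map (π.left.app (V i)) P = b :=
      (isIntegral_of_range_eq_invariants _ _ (H i).range_eq).comap_surjective (H i).1 b
    refine ⟨((hVa i).preimage π.left).fromSpec P, ?_⟩
    rw [← Scheme.Hom.comp_apply, ← hspec, Scheme.Hom.comp_apply]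
  refine ⟨inferInstance, h, ?_, fun x x' hxx' => ?_, fun V => (HW V).1, fun V => (HW V).range_eq⟩
  -- `π` is integral, hence closed, and a closed continuous surjection is a quotient map.
  · exact π.left.isClosedMap.isQuotientMap π.left.continuous hsurj
  · obtain ⟨i, hi⟩ := hcov (π.left x)
    have hx : x ∈ π.left ⁻¹ᵁ V i := hi
    have hx' : x' ∈ π.left ⁻¹ᵁ V i := by
      change π.left x' ∈ V i
      rwa [← hxx']
    rw [← SetLike.mem_coe, ← ((hVa i).preimage π.left).range_fromSpec] at hx hx'
    obtain ⟨P, rfl⟩ := hx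
    obtain ⟨Q, rfl⟩ := hx'
    refine exists_act_eq_of_specMap_eq _ _ (H i).range_eq _ P Q ?_
    refine (hVa i).fromSpec.isOpenEmbedding.injective ?_
    rw [← Scheme.Hom.comp_apply, ← Scheme.Hom.comp_apply, hspec, Scheme.Hom.comp_apply,
      Scheme.Hom.comp_apply, hxx']

end Criterion

/-! ### The ideal of the fixed locus -/

/-- An ideal sheaf that is locally generated by a nonzerodivisor restricts to an ideal with the
same property on every affine open set. -/
theorem exists_isRegularGeneratorAway {X : Scheme.{u}} (J : X.IdealSheafData)
    (hJ : ∀ x : X, ∃ U : X.affineOpens, x ∈ U.1 ∧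
      ∃ t ∈ nonZeroDivisors Γ(X, U), J.ideal U = Ideal.span {t})
    (W : X.affineOpens) (q : Ideal Γ(X, W)) [hq : q.IsPrime] :
    ∃ t, (J.ideal W).IsRegularGeneratorAway q.primeCompl t := by
  let P : Spec Γ(X, W) := ⟨q, hq⟩
  have hxW : W.2.fromSpec P ∈ W.1 := by
    rw [← SetLike.mem_coe, ← W.2.range_fromSpec]; exact ⟨P, rfl⟩
  obtain ⟨U, hxU, t, ht, hU⟩ := hJ (W.2.fromSpec P)
  -- The point has a neighbourhood that is basic open in both `W` and `U`, so the generator can be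
  -- transported through two localizations.
  obtain ⟨f, f', hff', hxf⟩ := exists_basicOpen_le_affine_inter W.2 U.2 _ ⟨hxW, hxU⟩
  have hfq : f ∉ q := by
    have : P ∈ W.2.fromSpec ⁻¹ᵁ X.basicOpen f := hxf
    rw [W.2.fromSpec_preimage_basicOpen] at this
    exact this
  let D : X.affineOpens := ⟨X.basicOpen f, W.2.basicOpen f⟩
  have hDW : D.1 ≤ W.1 := X.basicOpen_le f
  have hDU : D.1 ≤ U.1 := hff'.trans_le (X.basicOpen_le f')
  let r := (X.presheaf.map (homOfLE hDW).op).hom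
  let r' := (X.presheaf.map (homOfLE hDU).op).hom
  have hJW : (J.ideal W).map r = J.ideal D := J.map_ideal (U := D) (V := W) hDW
  have hJU : Ideal.span {r' t} = J.ideal D := by
    rw [← J.map_ideal (U := D) (V := U) hDU, hU, Ideal.map_span, Set.image_singleton]
    rfl
  have hrf : IsUnit (r f) := isUnit_map_of_eq_basicOpen f hDW rfl
  have hrf' : IsUnit (r' f') := isUnit_map_of_eq_basicOpen f' hDU hff'
  have hker : ∀ s, r s = 0 → ∃ n : ℕ, f ^ n * s = 0 :=
    IsAffineOpen.exists_pow_mul_eq_zero W.2 f hDW rfl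
  have hreg : ∀ c, r' t * c = 0 → c = 0 := by
    intro c hc
    obtain ⟨n, s, hs⟩ := IsAffineOpen.exists_eq_pow_mul U.2 f' hDU hff' c
    change r' s = r' f' ^ n * c at hs
    obtain ⟨m, hm⟩ := IsAffineOpen.exists_pow_mul_eq_zero U.2 f' hDU hff' (s * t) (by
      change r' (s * t) = 0
      rw [map_mul, hs]; linear_combination r' f' ^ n * hc)
    rw [← mul_assoc] at hm
    have h0 : r' (f' ^ m * s) = 0 := by rw [(mul_right_mem_nonZeroDivisors_eq_zero_iff ht).1 hm, map_zero]
    rw [map_mul, map_pow, hs] at h0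
    exact (hrf'.pow n).mul_right_eq_zero.1 ((hrf'.pow m).mul_right_eq_zero.1 h0)
  -- The generator over `U`, times a power of `f ∉ q`, comes from the ideal over `W`.
  obtain ⟨n, a, ha, hat⟩ : ∃ (n : ℕ), ∃ a ∈ J.ideal W, r a = r f ^ n * r' t := by
    have hmem : r' t ∈ (J.ideal W).map r := by
      rw [hJW, ← hJU]; exact Ideal.mem_span_singleton_self _
    have := W.2.isLocalization_basicOpen f
    obtain ⟨⟨a, ⟨_, n, rfl⟩⟩, h⟩ := (IsLocalization.mem_map_algebraMap_iff (Submonoid.powers f)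
      Γ(X, X.basicOpen f)).1 hmem
    refine ⟨n, a, a.2, ?_⟩
    rw [mul_comm, ← map_pow]
    exact h.symm
  refine ⟨a, ha, fun b hb => ?_, fun b hb => ?_⟩
  · obtain ⟨c, hc⟩ : r' t ∣ r b := by
      rw [← Ideal.mem_span_singleton, hJU, ← hJW]
      exact Ideal.mem_map_of_mem r hb
    obtain ⟨m, s, hs⟩ := IsAffineOpen.exists_eq_pow_mul W.2 f hDW rfl c
    change r s = r f ^ m * c at hs
    obtain ⟨l, hl⟩ := hker (f ^ n * f ^ m * b - a * s) (by
      rw [map_sub, map_mul, map_mul, map_mul, map_pow, map_pow, hc, hat, hs]; ring)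
    exact ⟨f ^ (l + n + m), q.primeCompl.pow_mem hfq _, f ^ l * s, by
      linear_combination hl⟩
  · obtain ⟨l, hl⟩ := hker b (hreg _ ((hrf.pow n).mul_right_eq_zero.1 (by
      rw [← mul_assoc, ← hat, ← map_mul, hb, map_zero])))
    exact ⟨f ^ l, q.primeCompl.pow_mem hfq _, hl⟩

theorem iterate_sub_mem_movedIdeal {A : Type*} [CommRing A] (σ : A → A) (n : ℕ) (a : A) :
    σ^[n] a - a ∈ movedIdeal σ := by
  induction n with
  | zero => simp
  | succ n ih =>
    rw [Function.iterate_succ_apply']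
    have h := add_mem (Ideal.subset_span ⟨σ^[n] a, rfl⟩ : σ (σ^[n] a) - σ^[n] a ∈ movedIdeal σ) ih
    rwa [sub_add_sub_cancel] at h

section Cyclic

variable {S : Scheme.{u}} {G : Type v} [Group G] {X : Over S} {ρ : G →* Aut X}
  {W : X.left.Opens} (hW : IsStable ρ W)

theorem iterate_pullbackSection (g : G) (n : ℕ)
    (a : Γ(X.left, W)) : (pullbackSection hW g)^[n] a = pullbackSection hW (g ^ n) a := by
  induction n with
  | zero => rw [pow_zero, pullbackSection_one]; rfl
  | succ n ih => rw [Function.iterate_succ_apply', ih, pow_succ, pullbackSection_mul]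

/-- A generator suffices, since `σ^[n] a - a` telescopes into differences moved by `σ`. -/
theorem movedIdeal_pullbackSection [Finite G] {g : G} (hg : ∀ h, h ∈ Subgroup.zpowers g) : movedIdeal (pullbackSection hW g) =
      Ideal.span {b | ∃ g a, pullbackSection hW g a - a = b} := by
  refine le_antisymm (Ideal.span_le.2 ?_) (Ideal.span_le.2 ?_)
  · rintro _ ⟨a, rfl⟩
    exact Ideal.subset_span ⟨g, a, rfl⟩
  · rintro _ ⟨h, a, rfl⟩
    obtain ⟨n, rfl⟩ := mem_powers_iff_mem_zpowers.2 (hg h)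
    change pullbackSection hW (g ^ n) a - a ∈ _
    rw [← iterate_pullbackSection]
    exact iterate_sub_mem_movedIdeal (pullbackSection hW g) n a

theorem pullbackSection_eq_self [Finite G] {g : G} (hg : ∀ h, h ∈ Subgroup.zpowers g)
    {a : Γ(X.left, W)} (ha : pullbackSection hW g a = a)
    (h : G) : pullbackSection hW h a = a := by
  obtain ⟨n, rfl⟩ := mem_powers_iff_mem_zpowers.2 (hg h)
  change pullbackSection hW (g ^ n) a = a
  rw [← iterate_pullbackSection]
  exact Function.iterate_fixed ha n

end Cyclic

theorem fromSpec_appLE_self {X : Scheme.{u}} {W : X.Opens} (hW : IsAffineOpen W)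
    (e : ⊤ ≤ hW.fromSpec ⁻¹ᵁ W) : hW.fromSpec.appLE W ⊤ e = (Scheme.ΓSpecIso _).inv := by
  rw [Scheme.Hom.appLE, hW.fromSpec_app_self, Category.assoc, ← Functor.map_comp]
  exact (congrArg _ ((Spec Γ(X, W)).presheaf.map_id _)).trans (Category.comp_id _)

theorem specMap_comp_fromSpec_appLE {X : Scheme.{u}} {W : X.Opens} (hW : IsAffineOpen W)
    {R : CommRingCat.{u}} (m : Γ(X, W) ⟶ R) (e : ⊤ ≤ (Spec.map m ≫ hW.fromSpec) ⁻¹ᵁ W) :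
    (Spec.map m ≫ hW.fromSpec).appLE W ⊤ e = m ≫ (Scheme.ΓSpecIso R).inv := by
  have e' : ⊤ ≤ hW.fromSpec ⁻¹ᵁ W := by rw [hW.fromSpec_preimage_self]
  rw [← Scheme.Hom.appLE_comp_appLE _ _ W ⊤ ⊤ e' le_top, fromSpec_appLE_self,
    Scheme.ΓSpecIso_inv_naturality]
  congr 1

section FixedLocus

variable {S : Scheme.{u}} {G : Type v} [Group G] [Finite G] {X : Over S} {ρ : G →* Aut X}

/-- The component at `1` of the pullback condition identifies the two projections; the component at
`g` then gives the claim. -/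
theorem fixedLocusι_act (g : G) : fixedLocusι ρ ≫ act ρ g = fixedLocusι ρ := by
  let q : fixedLocus ρ ⟶ X := pullback.snd (Pi.lift fun _ : G => 𝟙 X) (Pi.lift fun g : G => act ρ g)
  have h : ∀ g, fixedLocusι ρ = q ≫ act ρ g := fun g => by
    have h := congr($(pullback.condition (f := Pi.lift fun _ : G => 𝟙 X)
      (g := Pi.lift fun g : G => act ρ g)) ≫ Pi.π (fun _ => X) g)
    simp only [Category.assoc, Limits.Pi.lift_π, Category.comp_id] at h
    exact h
  have h1 : fixedLocusι ρ = q := by rw [h 1, act_one, Category.comp_id]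
  rw [h1]
  exact (h g).symm.trans h1

/-- The closed subscheme `Spec (A ⧸ I)` is fixed pointwise by `G`, so it maps to the fixed locus by
the universal property, and functions vanishing there lie in `I`. Conversely `a` and its translate
by `g` agree on the fixed locus. -/
theorem ker_fixedLocusι_ideal [QuasiCompact (fixedLocusι ρ).left] (W : X.left.affineOpens)
    (hW : IsStable ρ W.1) : (fixedLocusι ρ).left.ker.ideal W =
      Ideal.span {b | ∃ g a, pullbackSection hW g a - a = b} := by
  set I := Ideal.span {b | ∃ g a, pullbackSection hW g a - a = b}
  rw [Scheme.Hom.ker_apply]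
  apply le_antisymm
  · intro a ha
    let m : Γ(X.left, W.1) ⟶ CommRingCat.of (Γ(X.left, W.1) ⧸ I) :=
      CommRingCat.ofHom (Ideal.Quotient.mk I)
    let j : Spec (CommRingCat.of (Γ(X.left, W.1) ⧸ I)) ⟶ X.left := Spec.map m ≫ W.2.fromSpec
    let j' : Over.mk (j ≫ X.hom) ⟶ X := Over.homMk j
    have hj : ∀ g, j' ≫ act ρ g = j' := by
      intro g
      ext1
      change (Spec.map m ≫ W.2.fromSpec) ≫ (act ρ g).left = Spec.map m ≫ W.2.fromSpec
      rw [Category.assoc, ← IsAffineOpen.SpecMap_appLE_fromSpec _ W.2 W.2 (hW g),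
        ← Category.assoc, ← Spec.map_comp]
      congr 2
      ext a
      exact Ideal.Quotient.eq.2 (Ideal.subset_span ⟨g, a, rfl⟩)
    let l : Over.mk (j ≫ X.hom) ⟶ fixedLocus ρ := pullback.lift j' j' (by
      refine Limits.Pi.hom_ext _ _ fun g => ?_
      simp [hj g])
    have hl : l ≫ fixedLocusι ρ = j' := pullback.lift_fst ..
    have hl' : l.left ≫ (fixedLocusι ρ).left = Spec.map m ≫ W.2.fromSpec := congr(($hl).left)
    have key : ∀ (f : Spec (CommRingCat.of (Γ(X.left, W.1) ⧸ I)) ⟶ X.left) (e : ⊤ ≤ f ⁻¹ᵁ W.1),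
        f = Spec.map m ≫ W.2.fromSpec → f.appLE W.1 ⊤ e = m ≫ (Scheme.ΓSpecIso _).inv := by
      rintro f e rfl
      exact specMap_comp_fromSpec_appLE W.2 m e
    have e : ⊤ ≤ (l.left ≫ (fixedLocusι ρ).left) ⁻¹ᵁ W.1 := by
      rw [hl', Scheme.Hom.comp_preimage, W.2.fromSpec_preimage_self]
      rfl
    have h1 := key _ e hl'
    rw [← Scheme.Hom.appLE_comp_appLE _ _ W.1 _ ⊤ le_rfl e, Scheme.Hom.appLE_eq_app] at h1
    have h2 : (Scheme.ΓSpecIso (CommRingCat.of (Γ(X.left, W.1) ⧸ I))).inv (m a) = 0 := by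
      rw [← CommRingCat.comp_apply, ← h1, CommRingCat.comp_apply]
      exact (congrArg _ ha).trans (map_zero _)
    have h3 : m a = 0 := by
      have := congrArg (Scheme.ΓSpecIso (CommRingCat.of (Γ(X.left, W.1) ⧸ I))).hom h2
      simpa using this
    exact Ideal.Quotient.eq_zero_iff_mem.1 h3
  · refine Ideal.span_le.2 ?_
    rintro _ ⟨g, a, rfl⟩
    have : ∀ (f : (fixedLocus ρ).left ⟶ X.left) (e : (fixedLocusι ρ).left ⁻¹ᵁ W.1 ≤ f ⁻¹ᵁ W.1),
        f = (fixedLocusι ρ).left → f.appLE W.1 _ e = (fixedLocusι ρ).left.app W.1 := by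
      rintro f e rfl
      exact Scheme.Hom.appLE_eq_app _
    have h1 := this ((fixedLocusι ρ).left ≫ (act ρ g).left) (by
      rw [Scheme.Hom.comp_preimage]; exact Scheme.Hom.preimage_mono _ (hW g))
      (by rw [← Over.comp_left, fixedLocusι_act g])
    rw [← Scheme.Hom.appLE_comp_appLE _ _ _ W.1 _ (hW g) le_rfl, Scheme.Hom.appLE_eq_app] at h1
    change (fixedLocusι ρ).left.app W.1 (pullbackSection hW g a - a) = 0
    rw [map_sub, sub_eq_zero]
    exact congr($h1 a)

end FixedLocus

/-! ### Smoothness of quotients -/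

/-- Every quotient of a smooth scheme by a group of prime order, invertible in the base field,
whose fixed locus is a divisor, is smooth. -/
theorem IsQuotient.smooth {k : Type u} [Field k] {p : ℕ} (hp : p.Prime) (hpk : (p : k) ≠ 0)
    {G : Type v} [Group G] [Finite G] (hG : Nat.card G = p)
    {X Y : Over (Spec (CommRingCat.of k))} (hX : Smooth X.hom) {ρ : G →* Aut X}
    (hD : IsEffectiveCartierDivisor (fixedLocusι ρ).left) {π : X ⟶ Y} (hπ : IsQuotient ρ π) :
    Smooth Y.hom := by
  have := hπ.isAffineHom
  have := hD.isClosedImmersion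
  have : Fact p.Prime := ⟨hp⟩
  have : IsCyclic G := isCyclic_of_prime_card hG
  obtain ⟨g, hg⟩ := IsCyclic.exists_generator (α := G)
  have : IsZariskiLocalAtSource (@Smooth.{u}) := HasRingHomProperty.instIsZariskiLocalAtSource
  rw [IsZariskiLocalAtSource.iff_of_openCover (P := @Smooth) Y.left.directedAffineCover]
  intro V
  have hV : IsAffineOpen V.1 := V.2
  have hU : IsAffineOpen (π.left ⁻¹ᵁ V.1) := hV.preimage π.left
  have hst := preimage_isStable hπ.invariant V.1
  change Smooth (V.1.ι ≫ Y.hom)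
  have e : V.1.ι = hV.isoSpec.hom ≫ hV.fromSpec := by simp
  rw [e, Category.assoc]
  obtain ⟨c, hc⟩ := Spec.map_surjective (hV.fromSpec ≫ Y.hom)
  have hc' : Spec.map (c ≫ π.left.app V.1) = hU.fromSpec ≫ X.hom := by
    rw [Spec.map_comp, hc, ← Category.assoc, Scheme.Hom.app_eq_appLE,
      IsAffineOpen.SpecMap_appLE_fromSpec _ hV hU, Category.assoc, Over.w]
  have hs : (c ≫ π.left.app V.1).hom.Smooth := by
    rw [← HasRingHomProperty.Spec_iff (P := @Smooth), hc']
    infer_instance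
  suffices h : c.hom.Smooth by
    have : Smooth (hV.fromSpec ≫ Y.hom) := by
      rw [← hc, HasRingHomProperty.Spec_iff (P := @Smooth)]
      exact h
    infer_instance
  let := c.hom.toAlgebra
  let := (π.left.app V.1).hom.toAlgebra
  let := (c ≫ π.left.app V.1).hom.toAlgebra
  have : IsScalarTower k Γ(Y.left, V.1) Γ(X.left, π.left ⁻¹ᵁ V.1) := .of_algebraMap_eq fun _ => rfl
  have : Algebra.Smooth k Γ(X.left, π.left ⁻¹ᵁ V.1) := hs
  -- Invariants and moved ideal of `G` are those of its generator `g`, so `smooth_invariants`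
  -- applies to this single automorphism.
  let σ : Γ(X.left, π.left ⁻¹ᵁ V.1) →ₐ[k] Γ(X.left, π.left ⁻¹ᵁ V.1) :=
    { pullbackSection hst g with commutes' := fun x => pullbackSection_app hπ.invariant V.1 g _ }
  refine smooth_invariants (σ := σ) (A := Γ(X.left, π.left ⁻¹ᵁ V.1)) hp hpk (fun a => ?_)
    (hπ.app_injective V.1) (fun a => ?_) fun q _ => ?_
  · change (pullbackSection hst g)^[p] a = a
    rw [iterate_pullbackSection, ← hG, pow_card_eq_one', pullbackSection_one]
  · change pullbackSection hst g a = a ↔ a ∈ Set.range (π.left.app V.1)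
    rw [hπ.range_app]
    exact ⟨pullbackSection_eq_self hst hg, fun h => h g⟩
  · change ∃ t, (movedIdeal (pullbackSection hst g)).IsRegularGeneratorAway q.primeCompl t
    rw [movedIdeal_pullbackSection hst hg,
      ← ker_fixedLocusι_ideal ⟨π.left ⁻¹ᵁ V.1, hU⟩ hst]
    exact exists_isRegularGeneratorAway _ hD.exists_generator ⟨π.left ⁻¹ᵁ V.1, hU⟩ q

/-! ### Affine quotients and open immersions between them -/

/-- An injective morphism that is locally on the source an open immersion is an open immersion. -/
theorem isOpenImmersion_of_injective_of_locally {X Y : Scheme.{u}} (f : X ⟶ Y)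
    (hf : Function.Injective f) (H : ∀ x, ∃ (Z : Scheme.{u}) (j : Z ⟶ X), IsOpenImmersion j ∧
      x ∈ Set.range j ∧ IsOpenImmersion (j ≫ f)) : IsOpenImmersion f := by
  have hopen : IsOpenMap f := by
    refine IsOpenMap.of_nhds_le fun x => ?_
    obtain ⟨Z, j, hj, ⟨z, rfl⟩, hjf⟩ := H x
    have h := (j ≫ f).isOpenEmbedding.map_nhds_eq z
    rw [Scheme.Hom.comp_apply] at h
    rw [← h, ← j.isOpenEmbedding.map_nhds_eq z, Filter.map_map]
    rfl
  refine IsOpenImmersion.iff_isIso_stalkMap.2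
    ⟨.of_continuous_injective_isOpenMap f.continuous hf hopen, fun x => ?_⟩
  obtain ⟨Z, j, hj, ⟨z, rfl⟩, hjf⟩ := H x
  have h := Scheme.Hom.stalkMap_comp j f z
  have : IsIso (f.stalkMap (j z) ≫ j.stalkMap z) := by
    rw [← h]; exact inferInstanceAs (IsIso ((j ≫ f).stalkMap z))
  exact IsIso.of_isIso_comp_right _ (j.stalkMap z)

section Invariants

variable {S : Scheme.{u}} {G : Type v} [Group G] {X : Over S} {ρ : G →* Aut X}
  {W W' : X.left.Opens}

/-- The ring of invariant sections over a stable open set. -/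
def invariantSections (hW : IsStable ρ W) : Subring Γ(X.left, W) where
  carrier := {a | ∀ g, pullbackSection hW g a = a}
  mul_mem' ha hb g := by rw [map_mul, ha, hb]
  one_mem' g := map_one _
  add_mem' ha hb g := by rw [map_add, ha, hb]
  zero_mem' g := map_zero _
  neg_mem' ha g := by rw [map_neg, ha]

/-- The inclusion of the invariant sections into all sections. -/
def invariantSectionsι (hW : IsStable ρ W) :
    CommRingCat.of (invariantSections hW) ⟶ Γ(X.left, W) :=
  CommRingCat.ofHom (invariantSections hW).subtype

theorem range_invariantSectionsι (hW : IsStable ρ W) :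
    Set.range (invariantSectionsι hW) = {a | ∀ g, pullbackSection hW g a = a} :=
  Subtype.range_val

theorem invariantSectionsι_injective (hW : IsStable ρ W) :
    Function.Injective (invariantSectionsι hW) :=
  Subtype.val_injective

theorem invariantSectionsι_comp_appLE (hW : IsStable ρ W) (g : G) :
    invariantSectionsι hW ≫ (act ρ g).left.appLE W W (hW g) = invariantSectionsι hW := by
  ext a
  exact a.2 g

/-- Restriction of invariant sections. -/
def invariantSectionsMap (hW : IsStable ρ W) (hW' : IsStable ρ W') (hle : W' ≤ W) :
    CommRingCat.of (invariantSections hW) ⟶ CommRingCat.of (invariantSections hW') :=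
  CommRingCat.ofHom (((X.left.presheaf.map (homOfLE hle).op).hom.comp
    (invariantSections hW).subtype).codRestrict (invariantSections hW') fun a g => by
      change pullbackSection hW' g (X.left.presheaf.map (homOfLE hle).op a) = _
      rw [← map_pullbackSection hW, a.2 g]
      rfl)

theorem invariantSectionsMap_comp_ι (hW : IsStable ρ W) (hW' : IsStable ρ W') (hle : W' ≤ W) :
    invariantSectionsMap hW hW' hle ≫ invariantSectionsι hW' =
      invariantSectionsι hW ≫ X.left.presheaf.map (homOfLE hle).op := rfl

theorem basicOpen_isStable (hW : IsStable ρ W) (b : invariantSections hW) :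
    IsStable ρ (X.left.basicOpen b.1) := fun g => by
  have h := Scheme.basicOpen_appLE (act ρ g).left W W (hW g) b.1
  have hb : (act ρ g).left.appLE W W (hW g) b.1 = b.1 := b.2 g
  rw [hb] at h
  exact h.le.trans inf_le_right

variable [Finite G]

/-- The invariant sections over `W'` are the localization at `b` of those over `W`. -/
theorem isOpenImmersion_invariantSectionsMap (hW : IsStable ρ W) (hWa : IsAffineOpen W)
    (hW' : IsStable ρ W') (hle : W' ≤ W) (b : invariantSections hW)
    (hD : W' = X.left.basicOpen b.1) :
    IsOpenImmersion (Spec.map (invariantSectionsMap hW hW' hle)) := by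
  let r := invariantSectionsMap hW hW' hle
  let := r.hom.toAlgebra
  have hu : IsUnit (X.left.presheaf.map (homOfLE hle).op b.1) := isUnit_map_of_eq_basicOpen _ hle hD
  -- The inverse of an invariant unit is invariant, by uniqueness of inverses.
  have hunit : IsUnit (r b) := by
    obtain ⟨c, hc⟩ := hu.exists_right_inv
    refine IsUnit.of_mul_eq_one ⟨c, fun g => ?_⟩ (Subtype.ext hc)
    have h1 : pullbackSection hW' g (r b).1 = (r b).1 := (r b).2 g
    have h2 := congrArg (pullbackSection hW' g) hc
    change pullbackSection hW' g ((r b).1 * c) = _ at h2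
    rw [map_mul, h1, map_one] at h2
    exact hu.mul_left_cancel (h2.trans hc.symm)
  have : IsLocalization.Away b (invariantSections hW') := by
    refine IsLocalization.Away.mk _ hunit (fun a => ?_) fun a a' haa' => ?_
    · obtain ⟨n, s, hs, e⟩ := exists_invariant_lift
        (X.left.presheaf.map (homOfLE hle).op).hom (pullbackSection hW) (pullbackSection hW')
        (fun g a => map_pullbackSection _ _ _ g a) (f := b.1) b.2
        (IsAffineOpen.exists_eq_pow_mul hWa _ hle hD)
        (IsAffineOpen.exists_pow_mul_eq_zero hWa _ hle hD) a.2
      exact ⟨n, ⟨s, hs⟩, Subtype.ext ((mul_comm _ _).trans e.symm)⟩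
    · obtain ⟨n, hn⟩ := IsAffineOpen.exists_pow_mul_eq_zero hWa b.1 hle hD (a.1 - a'.1) (by
        rw [map_sub, sub_eq_zero]
        exact congrArg Subtype.val haa')
      refine ⟨n, Subtype.ext ?_⟩
      rw [mul_sub, sub_eq_zero] at hn
      exact hn
  exact IsOpenImmersion.of_isLocalization b

theorem specMap_invariantSectionsι_surjective (hW : IsStable ρ W) :
    Function.Surjective (Spec.map (invariantSectionsι hW)) :=
  (isIntegral_of_range_eq_invariants hW _ (range_invariantSectionsι hW)).comap_surjective
    (invariantSectionsι_injective hW)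

theorem specMap_invariantSectionsι_eq_iff (hW : IsStable ρ W) (hWa : IsAffineOpen W)
    (P Q : Spec Γ(X.left, W)) :
    Spec.map (invariantSectionsι hW) P = Spec.map (invariantSectionsι hW) Q ↔
      ∃ g, (act ρ g).left (hWa.fromSpec P) = hWa.fromSpec Q := by
  refine ⟨exists_act_eq_of_specMap_eq hW _ (range_invariantSectionsι hW) hWa P Q, ?_⟩
  rintro ⟨g, hg⟩
  rw [← Scheme.Hom.comp_apply, ← IsAffineOpen.SpecMap_appLE_fromSpec _ hWa hWa (hW g),
    Scheme.Hom.comp_apply] at hg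
  rw [← hWa.fromSpec.isOpenEmbedding.injective hg, ← Scheme.Hom.comp_apply, ← Spec.map_comp,
    invariantSectionsι_comp_appLE]

theorem exists_specMap_restriction_eq {X : Scheme.{u}} {W W' : X.Opens} (hWa : IsAffineOpen W)
    (hWa' : IsAffineOpen W') (hle : W' ≤ W) (P : Spec Γ(X, W)) (hP : hWa.fromSpec P ∈ W') :
    ∃ P', Spec.map (X.presheaf.map (homOfLE hle).op) P' = P := by
  rw [← SetLike.mem_coe, ← hWa'.range_fromSpec] at hP
  obtain ⟨P', hP'⟩ := hP
  refine ⟨P', hWa.fromSpec.isOpenEmbedding.injective ?_⟩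
  rw [← hP', ← Scheme.Hom.comp_apply, hWa.map_fromSpec hWa']

/-- The quotient map of `W` is closed, so the image of the complement of `W'` is closed. As `W'` is
stable, that image misses the image of `P`, and an invariant `b` separates the two. -/
theorem exists_basicOpen_le_of_isStable (hW : IsStable ρ W) (hWa : IsAffineOpen W)
    (hW' : IsStable ρ W') (P : Spec Γ(X.left, W)) (hP : hWa.fromSpec P ∈ W') :
    ∃ b : invariantSections hW, hWa.fromSpec P ∈ X.left.basicOpen b.1 ∧
      X.left.basicOpen b.1 ≤ W' := by
  let q := Spec.map (invariantSectionsι hW)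
  let Z : Set (Spec Γ(X.left, W)) := (hWa.fromSpec ⁻¹ᵁ W' : Set _)ᶜ
  have hZ : IsClosed Z := (hWa.fromSpec ⁻¹ᵁ W').isOpen.isClosed_compl
  have hqZ : IsClosed (q '' Z) := PrimeSpectrum.isClosedMap_comap_of_isIntegral _
    (isIntegral_of_range_eq_invariants hW _ (range_invariantSectionsι hW)) Z hZ
  have hPZ : q P ∈ (q '' Z)ᶜ := by
    rintro ⟨Q, hQ, hQP⟩
    obtain ⟨g, hg⟩ := (specMap_invariantSectionsι_eq_iff hW hWa P Q).1 hQP.symm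
    refine hQ ?_
    change hWa.fromSpec Q ∈ W'
    rw [← hg]
    exact hW' g hP
  obtain ⟨_, ⟨b, rfl⟩, hPb, hb⟩ :=
    PrimeSpectrum.isTopologicalBasis_basic_opens.exists_subset_of_mem_open hPZ hqZ.isOpen_compl
  have hmem : ∀ Q, hWa.fromSpec Q ∈ X.left.basicOpen b.1 ↔ q Q ∈ PrimeSpectrum.basicOpen b := by
    intro Q
    change Q ∈ hWa.fromSpec ⁻¹ᵁ X.left.basicOpen b.1 ↔ _
    rw [hWa.fromSpec_preimage_basicOpen]
    rfl
  refine ⟨b, (hmem P).2 hPb, fun x hx => ?_⟩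
  have hxW := X.left.basicOpen_le _ hx
  rw [← SetLike.mem_coe, ← hWa.range_fromSpec] at hxW
  obtain ⟨Q, rfl⟩ := hxW
  by_contra hQ
  exact hb ((hmem Q).1 hx) ⟨Q, hQ, rfl⟩

/-- Injective because points of either quotient are orbits in `X`. Around each orbit some invariant
`b` over `W` has its basic open set inside `W'`, and over it both quotients have the same
localization. -/
theorem isOpenImmersion_specMap_invariantSectionsMap (hW : IsStable ρ W) (hWa : IsAffineOpen W)
    (hW' : IsStable ρ W') (hWa' : IsAffineOpen W') (hle : W' ≤ W) :
    IsOpenImmersion (Spec.map (invariantSectionsMap hW hW' hle)) := by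
  have hcomm : ∀ {U V : X.left.Opens} (hU : IsStable ρ U) (hV : IsStable ρ V) (h : V ≤ U)
      (P : Spec Γ(X.left, V)), Spec.map (invariantSectionsMap hU hV h)
        (Spec.map (invariantSectionsι hV) P) = Spec.map (invariantSectionsι hU)
          (Spec.map (X.left.presheaf.map (homOfLE h).op) P) := by
    intro U V hU hV h P
    rw [← Scheme.Hom.comp_apply, ← Scheme.Hom.comp_apply, ← Spec.map_comp, ← Spec.map_comp,
      invariantSectionsMap_comp_ι]
  refine isOpenImmersion_of_injective_of_locally _ (fun x y hxy => ?_) fun x => ?_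
  · obtain ⟨P, rfl⟩ := specMap_invariantSectionsι_surjective hW' x
    obtain ⟨Q, rfl⟩ := specMap_invariantSectionsι_surjective hW' y
    rw [hcomm, hcomm, specMap_invariantSectionsι_eq_iff hW hWa, ← Scheme.Hom.comp_apply,
      ← Scheme.Hom.comp_apply, hWa.map_fromSpec hWa'] at hxy
    exact (specMap_invariantSectionsι_eq_iff hW' hWa' P Q).2 hxy
  · obtain ⟨P, rfl⟩ := specMap_invariantSectionsι_surjective hW' x
    have hP : hWa.fromSpec (Spec.map (X.left.presheaf.map (homOfLE hle).op) P) =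
        hWa'.fromSpec P := by
      rw [← Scheme.Hom.comp_apply, hWa.map_fromSpec hWa']
    have hPW' : hWa'.fromSpec P ∈ W' := by
      rw [← SetLike.mem_coe, ← hWa'.range_fromSpec]; exact ⟨P, rfl⟩
    obtain ⟨b, hPb, hb⟩ := exists_basicOpen_le_of_isStable hW hWa hW'
      (Spec.map (X.left.presheaf.map (homOfLE hle).op) P) (hP ▸ hPW')
    rw [hP] at hPb
    have hD := basicOpen_isStable hW b
    have hDa := hWa.basicOpen b.1
    obtain ⟨P', rfl⟩ := exists_specMap_restriction_eq hWa' hDa hb P hPb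
    have hDW' : X.left.basicOpen b.1 =
        X.left.basicOpen (invariantSectionsMap hW hW' hle b).1 := by
      have := X.left.basicOpen_res b.1 (homOfLE hle).op
      exact (inf_eq_right.2 hb).symm.trans this.symm
    refine ⟨_, Spec.map (invariantSectionsMap hW' hD hb),
      isOpenImmersion_invariantSectionsMap hW' hWa' hD hb _ hDW',
      ⟨Spec.map (invariantSectionsι hD) P', hcomm hW' hD hb P'⟩, ?_⟩
    have := isOpenImmersion_invariantSectionsMap hW hWa hD (hb.trans hle) b rfl
    rw [← Spec.map_comp]
    convert! this
    ext a
    exact congr($(X.left.presheaf.map_comp (homOfLE hle).op (homOfLE hb).op) a.1).symm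

end Invariants

/-! ### Gluing data for the quotient -/

noncomputable section Glue

variable {S : Scheme.{u}} {G : Type v} [Group G] {X : Over S} (ρ : G →* Aut X)

theorem isStable_inf {ρ : G →* Aut X} {W W' : X.left.Opens} (hW : IsStable ρ W)
    (hW' : IsStable ρ W') : IsStable ρ (W ⊓ W') :=
  fun g _ hx => ⟨hW g hx.1, hW' g hx.2⟩

/-- Under the isomorphism induced by `i`, and since the preimage is exactly `W`, the map `π` on
sections becomes the inclusion of the invariants. -/
theorem sectionsEqInvariants_of_comp_eq {ρ : G →* Aut X} {Y : Over S} {π : X ⟶ Y}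
    (h : ∀ g, act ρ g ≫ π = π) {W : X.left.Opens} (hW : IsStable ρ W) (hWa : IsAffineOpen W)
    (i : Spec (CommRingCat.of (invariantSections hW)) ⟶ Y.left) (_ : IsOpenImmersion i)
    (hi : hWa.fromSpec ≫ π.left = Spec.map (invariantSectionsι hW) ≫ i)
    (hπ : π.left ⁻¹ᵁ (i ''ᵁ ⊤) = W) : SectionsEqInvariants h (i ''ᵁ ⊤) := by
  have hle : W ≤ π.left ⁻¹ᵁ (i ''ᵁ ⊤) := hπ.ge
  let e := (i.appIso ⊤) ≪≫ (Scheme.ΓSpecIso (CommRingCat.of (invariantSections hW)))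
  have hi' : ⊤ ≤ i ⁻¹ᵁ (i ''ᵁ ⊤) := (i.preimage_image_eq ⊤).ge
  have he : (i.appIso ⊤).hom = i.appLE _ ⊤ hi' := i.appIso_hom' ⊤
  have he' : Function.Bijective e.hom := ConcreteCategory.bijective_of_isIso e.hom
  have key : π.left.appLE (i ''ᵁ ⊤) W hle = e.hom ≫ invariantSectionsι hW := by
    have h0 : ∀ (f : Spec Γ(X.left, W) ⟶ Y.left) (h : ⊤ ≤ f ⁻¹ᵁ (i ''ᵁ ⊤)),
        f = Spec.map (invariantSectionsι hW) ≫ i → f.appLE _ ⊤ h =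
          (i.appIso ⊤).hom ≫ (Spec.map (invariantSectionsι hW)).appTop := by
      rintro f h rfl
      rw [he, ← Scheme.Hom.appLE_comp_appLE _ _ _ ⊤ ⊤ hi' le_top]
      congr 1
    have h2 : ⊤ ≤ hWa.fromSpec ⁻¹ᵁ W := hWa.fromSpec_preimage_self.ge
    have h1 := h0 (hWa.fromSpec ≫ π.left) (h2.trans (hWa.fromSpec.preimage_mono hle)) hi
    rw [← Scheme.Hom.appLE_comp_appLE _ _ _ W ⊤ hle h2, fromSpec_appLE_self,
      Iso.comp_inv_eq] at h1
    rw [h1, Category.assoc, Scheme.ΓSpecIso_naturality, Iso.trans_hom, Category.assoc]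
  let r := X.left.presheaf.map (homOfLE hle).op
  have hr : Function.Injective r := by
    have : homOfLE hle = eqToHom hπ.symm := Subsingleton.elim _ _
    have : IsIso r := by
      change IsIso (X.left.presheaf.map (homOfLE hle).op)
      rw [this]
      infer_instance
    exact (ConcreteCategory.bijective_of_isIso r).1
  have hπ' : ∀ b, r (π.left.app _ b) = (e.hom b).1 := fun b => congr($key b)
  refine ⟨fun b b' h => he'.1 (Subtype.ext ?_), fun a ha => ?_⟩
  · rw [← hπ', ← hπ']
    exact congrArg r h
  · obtain ⟨b, hb⟩ := he'.2 ⟨r a, fun g => by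
      rw [← map_pullbackSection (preimage_isStable h _) hW hle, ha]⟩
    refine ⟨b, hr ?_⟩
    rw [hπ', hb]

/-- The stable affine open sets. -/
abbrev StableAffineOpens : Type u := {W : X.left.Opens // IsAffineOpen W ∧ IsStable ρ W}

variable {ρ} in
theorem StableAffineOpens.le {W W' : StableAffineOpens ρ} (f : W ⟶ W') : W.1 ≤ W'.1 :=
  leOfHom f

variable {ρ} in
/-- The intersection of two stable affine open sets. -/
def StableAffineOpens.inf [X.left.IsSeparated] (W W' : StableAffineOpens ρ) :
    StableAffineOpens ρ :=
  ⟨W.1 ⊓ W'.1, W.2.1.inf W'.2.1, isStable_inf W.2.2 W'.2.2⟩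

variable {ρ} in
/-- The inclusion of an intersection in the first open set. -/
def StableAffineOpens.infLeft [X.left.IsSeparated] (W W' : StableAffineOpens ρ) : W.inf W' ⟶ W :=
  homOfLE (show W.1 ⊓ W'.1 ≤ W.1 from inf_le_left)

variable {ρ} in
/-- The inclusion of an intersection in the second open set. -/
def StableAffineOpens.infRight [X.left.IsSeparated] (W W' : StableAffineOpens ρ) : W.inf W' ⟶ W' :=
  homOfLE (show W.1 ⊓ W'.1 ≤ W'.1 from inf_le_right)

/-- The affine quotients of the stable affine open sets. -/
def affineQuotient : StableAffineOpens ρ ⥤ Scheme.{u} where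
  obj W := Spec (CommRingCat.of (invariantSections W.2.2))
  map {W W'} f := Spec.map (invariantSectionsMap W'.2.2 W.2.2 (StableAffineOpens.le f))
  map_id W := by
    rw [← Spec.map_id]
    congr 1
    ext a
    exact congr($(X.left.presheaf.map_id _) a.1)
  map_comp {W W' W''} f g := by
    refine (congrArg Spec.map ?_).trans (Spec.map_comp _ _)
    ext a
    exact congr($(X.left.presheaf.map_comp (homOfLE (StableAffineOpens.le g)).op
      (homOfLE (StableAffineOpens.le f)).op) a.1)

/-- The quotient map of a stable affine open set. -/
def affineQuotientMap (W : StableAffineOpens ρ) :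
    Spec Γ(X.left, W.1) ⟶ (affineQuotient ρ).obj W :=
  Spec.map (invariantSectionsι W.2.2)

theorem affineQuotientMap_naturality {W W' : StableAffineOpens ρ} (f : W ⟶ W') :
    Spec.map (X.left.presheaf.map (homOfLE (StableAffineOpens.le f)).op) ≫ affineQuotientMap ρ W' =
      affineQuotientMap ρ W ≫ (affineQuotient ρ).map f :=
  (Spec.map_comp _ _).symm.trans (Spec.map_comp (invariantSectionsMap W'.2.2 W.2.2 (StableAffineOpens.le f)) (invariantSectionsι W.2.2))

theorem specMap_appLE_affineQuotientMap (W : StableAffineOpens ρ) (g : G) :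
    Spec.map ((act ρ g).left.appLE W.1 W.1 (W.2.2 g)) ≫ affineQuotientMap ρ W =
      affineQuotientMap ρ W :=
  (Spec.map_comp _ _).symm.trans (congrArg Spec.map (invariantSectionsι_comp_appLE W.2.2 g))

/-- The open cover of `X` by stable affine open sets. -/
def stableCover (hρ : ∀ x, ∃ W : StableAffineOpens ρ, x ∈ W.1) : X.left.OpenCover where
  I₀ := StableAffineOpens ρ
  X W := Spec Γ(X.left, W.1)
  f W := W.2.1.fromSpec
  mem₀ := by
    rw [Scheme.presieve₀_mem_precoverage_iff]
    refine ⟨fun x => ?_, fun W => W.2.1.isOpenImmersion_fromSpec⟩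
    obtain ⟨W, hW⟩ := hρ x
    rw [← SetLike.mem_coe, ← W.2.1.range_fromSpec] at hW
    exact ⟨W, hW⟩

variable (hρ : ∀ x, ∃ W : StableAffineOpens ρ, x ∈ W.1)

instance : Preorder (stableCover ρ hρ).I₀ := inferInstanceAs (Preorder (StableAffineOpens ρ))

theorem fromSpec_mem {X : Scheme.{u}} {W : X.Opens} (hW : IsAffineOpen W) (P : Spec Γ(X, W)) :
    hW.fromSpec P ∈ W := by
  rw [← SetLike.mem_coe, ← hW.range_fromSpec]
  exact ⟨P, rfl⟩

theorem exists_fromSpec_eq {X : Scheme.{u}} {W : X.Opens} (hW : IsAffineOpen W) {x : X}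
    (hx : x ∈ W) : ∃ P, hW.fromSpec P = x := by
  rwa [← SetLike.mem_coe, ← hW.range_fromSpec] at hx

theorem isOpenImmersion_specMap_restriction {X : Scheme.{u}} {W W' : X.Opens}
    (hW : IsAffineOpen W) (hW' : IsAffineOpen W') (hle : W' ≤ W) :
    IsOpenImmersion (Spec.map (X.presheaf.map (homOfLE hle).op)) := by
  have := hW'.isOpenImmersion_fromSpec
  have := hW.isOpenImmersion_fromSpec
  have : IsOpenImmersion (Spec.map (X.presheaf.map (homOfLE hle).op) ≫ hW.fromSpec) := by
    rwa [hW.map_fromSpec hW']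
  exact IsOpenImmersion.of_comp _ hW.fromSpec

theorem exists_lift_restriction_eq {X : Scheme.{u}} {W W' : X.Opens} (hW : IsAffineOpen W)
    (hW' : IsAffineOpen W') (hi : IsAffineOpen (W ⊓ W'))
    (x : (pullback hW.fromSpec hW'.fromSpec : Scheme)) :
    ∃ y, pullback.lift (Spec.map (X.presheaf.map (homOfLE (inf_le_left : W ⊓ W' ≤ W)).op))
      (Spec.map (X.presheaf.map (homOfLE (inf_le_right : W ⊓ W' ≤ W')).op))
      ((hW.map_fromSpec hi _).trans (hW'.map_fromSpec hi _).symm) y = x := by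
  have := hW.isOpenImmersion_fromSpec
  have := hW'.isOpenImmersion_fromSpec
  let p := pullback.fst hW.fromSpec hW'.fromSpec ≫ hW.fromSpec
  have hp : p x ∈ W ⊓ W' := by
    refine ⟨?_, ?_⟩
    · rw [Scheme.Hom.comp_apply]
      exact fromSpec_mem hW _
    · change (pullback.fst hW.fromSpec hW'.fromSpec ≫ hW.fromSpec) x ∈ _
      rw [pullback.condition, Scheme.Hom.comp_apply]
      exact fromSpec_mem hW' _
  obtain ⟨y, hy⟩ := exists_fromSpec_eq hi hp
  refine ⟨y, p.isOpenEmbedding.injective ?_⟩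
  rw [← hy, ← Scheme.Hom.comp_apply, pullback.lift_fst_assoc, hW.map_fromSpec hi]

instance [X.left.IsSeparated] : (stableCover ρ hρ).LocallyDirected where
  trans {W W'} f := Spec.map (X.left.presheaf.map (homOfLE (StableAffineOpens.le f)).op)
  trans_id W := (congrArg Spec.map (X.left.presheaf.map_id _)).trans (Spec.map_id _)
  trans_comp f g := (congrArg Spec.map (X.left.presheaf.map_comp
    (homOfLE (StableAffineOpens.le g)).op (homOfLE (StableAffineOpens.le f)).op)).trans
      (Spec.map_comp _ _)
  w {W W'} f := W'.2.1.map_fromSpec W.2.1 _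
  directed {W W'} x := by
    obtain ⟨y, hy⟩ := exists_lift_restriction_eq W.2.1 W'.2.1 (StableAffineOpens.inf W W').2.1 x
    exact ⟨StableAffineOpens.inf W W', StableAffineOpens.infLeft W W',
      StableAffineOpens.infRight W W', y, hy⟩
  property_trans {W W'} f :=
    isOpenImmersion_specMap_restriction W'.2.1 W.2.1 (StableAffineOpens.le f)

theorem map_affineQuotientMap {W W' : StableAffineOpens ρ} (f : W ⟶ W') (P : Spec Γ(X.left, W.1))
    (Q : Spec Γ(X.left, W'.1)) (h : W.2.1.fromSpec P = W'.2.1.fromSpec Q) :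
    (affineQuotient ρ).map f (affineQuotientMap ρ W P) = affineQuotientMap ρ W' Q := by
  rw [← Scheme.Hom.comp_apply, ← affineQuotientMap_naturality, Scheme.Hom.comp_apply]
  congr 1
  refine W'.2.1.fromSpec.isOpenEmbedding.injective ?_
  rw [← h, ← Scheme.Hom.comp_apply]
  exact congr($(W'.2.1.map_fromSpec W.2.1 _) P)

variable [Finite G]

instance {W W' : StableAffineOpens ρ} (f : W ⟶ W') : IsOpenImmersion ((affineQuotient ρ).map f) :=
  isOpenImmersion_specMap_invariantSectionsMap W'.2.2 W'.2.1 W.2.2 W.2.1 (StableAffineOpens.le f)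

theorem affineQuotientMap_surjective (W : StableAffineOpens ρ) :
    Function.Surjective (affineQuotientMap ρ W) :=
  specMap_invariantSectionsι_surjective W.2.2

theorem affineQuotientMap_eq_iff (W : StableAffineOpens ρ) (P Q : Spec Γ(X.left, W.1)) :
    affineQuotientMap ρ W P = affineQuotientMap ρ W Q ↔
      ∃ g, (act ρ g).left (W.2.1.fromSpec P) = W.2.1.fromSpec Q :=
  specMap_invariantSectionsι_eq_iff W.2.2 W.2.1 P Q

/-- Points of two charts with the same image in a third represent one orbit. Since `W₁` is stable,
it contains the representative `P₂`, which therefore lies in the stable affine open `W₁ ⊓ W₂`. -/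
instance [X.left.IsSeparated] : (affineQuotient ρ ⋙ Scheme.forget).IsLocallyDirected where
  cond {W₁ W₂ W} f₁ f₂ x₁ x₂ h := by
    obtain ⟨P₁, rfl⟩ := affineQuotientMap_surjective ρ W₁ x₁
    obtain ⟨P₂, rfl⟩ := affineQuotientMap_surjective ρ W₂ x₂
    obtain ⟨Q₁, hQ₁⟩ := exists_fromSpec_eq W.2.1 (StableAffineOpens.le f₁ (fromSpec_mem W₁.2.1 P₁))
    obtain ⟨Q₂, hQ₂⟩ := exists_fromSpec_eq W.2.1 (StableAffineOpens.le f₂ (fromSpec_mem W₂.2.1 P₂))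
    change (affineQuotient ρ).map f₁ _ = (affineQuotient ρ).map f₂ _ at h
    rw [map_affineQuotientMap ρ f₁ P₁ Q₁ hQ₁.symm, map_affineQuotientMap ρ f₂ P₂ Q₂ hQ₂.symm,
      affineQuotientMap_eq_iff, hQ₁, hQ₂] at h
    obtain ⟨g, hg⟩ := h
    have hmem : W₂.2.1.fromSpec P₂ ∈ (StableAffineOpens.inf W₁ W₂).1 :=
      ⟨hg ▸ W₁.2.2 g (fromSpec_mem W₁.2.1 P₁), fromSpec_mem W₂.2.1 P₂⟩
    obtain ⟨P, hP⟩ := exists_fromSpec_eq (StableAffineOpens.inf W₁ W₂).2.1 hmem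
    obtain ⟨P', hP'⟩ := exists_fromSpec_eq W₁.2.1 hmem.1
    refine ⟨W₁.inf W₂, W₁.infLeft W₂, W₁.infRight W₂,
      affineQuotientMap ρ _ P, ?_, ?_⟩
    · refine (map_affineQuotientMap ρ (W₁.infLeft W₂) P P' (hP.trans hP'.symm)).trans ?_
      refine ((affineQuotientMap_eq_iff ρ W₁ P₁ P').2 ⟨g, ?_⟩).symm
      rw [hg, hP']
    · exact map_affineQuotientMap ρ (W₁.infRight W₂) P P₂ hP

end Glue

/-! ### The glued quotient -/

noncomputable section Quotient

variable {R : CommRingCat.{u}} {G : Type v} [Group G] {X : Over (Spec R)} (ρ : G →* Aut X)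

/-- The structure map of the sections over an affine open set of a scheme over `Spec R`. -/
def structureHom {W : X.left.Opens} (hW : IsAffineOpen W) : R ⟶ Γ(X.left, W) :=
  Spec.preimage (hW.fromSpec ≫ X.hom)

theorem specMap_structureHom {W : X.left.Opens} (hW : IsAffineOpen W) :
    Spec.map (structureHom hW) = hW.fromSpec ≫ X.hom :=
  Spec.map_preimage _

theorem structureHom_comp_appLE (W : StableAffineOpens ρ) (g : G) :
    structureHom W.2.1 ≫ (act ρ g).left.appLE W.1 W.1 (W.2.2 g) = structureHom W.2.1 := by
  refine Spec.map_injective ?_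
  rw [Spec.map_comp, specMap_structureHom, ← Category.assoc,
    IsAffineOpen.SpecMap_appLE_fromSpec _ W.2.1 W.2.1, Category.assoc, Over.w]

theorem structureHom_comp_map {W W' : StableAffineOpens ρ} (f : W ⟶ W') :
    structureHom W'.2.1 ≫ X.left.presheaf.map (homOfLE (StableAffineOpens.le f)).op =
      structureHom W.2.1 := by
  refine Spec.map_injective ?_
  rw [Spec.map_comp, specMap_structureHom, ← Category.assoc, W'.2.1.map_fromSpec W.2.1,
    specMap_structureHom]

/-- The structure map of the invariant sections over a stable affine open set. -/
def invariantStructureHom (W : StableAffineOpens ρ) :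
    R ⟶ CommRingCat.of (invariantSections W.2.2) :=
  CommRingCat.ofHom ((structureHom W.2.1).hom.codRestrict (invariantSections W.2.2)
    fun r g => congr($(structureHom_comp_appLE ρ W g) r))

theorem invariantStructureHom_comp_ι (W : StableAffineOpens ρ) :
    invariantStructureHom ρ W ≫ invariantSectionsι W.2.2 = structureHom W.2.1 := rfl

/-- The structure morphisms of the affine quotients. -/
def affineQuotientCocone : Cocone (affineQuotient ρ) where
  pt := Spec R
  ι :=
    { app W := Spec.map (invariantStructureHom ρ W)
      naturality {W W'} f := by
        refine ((Spec.map_comp _ _).symm.trans (congrArg Spec.map ?_)).trans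
          (Category.comp_id _).symm
        ext r
        exact congr($(structureHom_comp_map ρ f) r) }

variable [Finite G] [X.left.IsSeparated]

/-- The quotient of a separated scheme that is covered by stable affine open sets. -/
def quotient : Over (Spec R) := Over.mk (colimit.desc (affineQuotient ρ) (affineQuotientCocone ρ))

variable (hρ : ∀ x, ∃ W : StableAffineOpens ρ, x ∈ W.1)

theorem affineQuotientMap_ι {W W' : StableAffineOpens ρ} (f : W ⟶ W') :
    Spec.map (X.left.presheaf.map (homOfLE (StableAffineOpens.le f)).op) ≫
      affineQuotientMap ρ W' ≫ colimit.ι (affineQuotient ρ) W' =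
        affineQuotientMap ρ W ≫ colimit.ι (affineQuotient ρ) W := by
  have h := congr($(affineQuotientMap_naturality ρ f) ≫ colimit.ι (affineQuotient ρ) W')
  rwa [Category.assoc, Category.assoc, colimit.w] at h

theorem affineQuotientMap_ι_hom (W : StableAffineOpens ρ) :
    (affineQuotientMap ρ W ≫ colimit.ι (affineQuotient ρ) W) ≫ (quotient ρ).hom =
      W.2.1.fromSpec ≫ X.hom := by
  have h : colimit.ι (affineQuotient ρ) W ≫ (quotient ρ).hom =
    Spec.map (invariantStructureHom ρ W) := colimit.ι_desc _ _
  refine (Category.assoc _ _ _).trans ((congrArg (affineQuotientMap ρ W ≫ ·) h).trans ?_)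
  refine (Spec.map_comp _ _).symm.trans ?_
  rw [invariantStructureHom_comp_ι, specMap_structureHom]

/-- The quotient morphism. -/
def quotientMap : X ⟶ quotient ρ :=
  (stableCover ρ hρ).glueMorphismsOverOfLocallyDirected
    (fun W => affineQuotientMap ρ W ≫ colimit.ι (affineQuotient ρ) W)
    (fun f => affineQuotientMap_ι ρ f) (affineQuotientMap_ι_hom ρ)

theorem fromSpec_quotientMap (W : StableAffineOpens ρ) :
    W.2.1.fromSpec ≫ (quotientMap ρ hρ).left =
      affineQuotientMap ρ W ≫ colimit.ι (affineQuotient ρ) W :=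
  (stableCover ρ hρ).map_glueMorphismsOverOfLocallyDirected_left _ _ _ W

theorem act_quotientMap (g : G) : act ρ g ≫ quotientMap ρ hρ = quotientMap ρ hρ := by
  ext1
  refine (stableCover ρ hρ).hom_ext _ _ fun (W : StableAffineOpens ρ) => ?_
  change W.2.1.fromSpec ≫ (act ρ g).left ≫ (quotientMap ρ hρ).left =
    W.2.1.fromSpec ≫ (quotientMap ρ hρ).left
  rw [← Category.assoc, ← IsAffineOpen.SpecMap_appLE_fromSpec _ W.2.1 W.2.1 (W.2.2 g),
    Category.assoc, fromSpec_quotientMap]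
  exact (Category.assoc _ _ _).symm.trans
    (congrArg (· ≫ colimit.ι (affineQuotient ρ) W) (specMap_appLE_affineQuotientMap ρ W g))

/-- The image of a stable affine open set in the quotient. -/
def quotientOpen (W : StableAffineOpens ρ) : (quotient ρ).left.Opens :=
  colimit.ι (affineQuotient ρ) W ''ᵁ ⊤

theorem mem_quotientOpen (W : StableAffineOpens ρ) (y : (quotient ρ).left) :
    y ∈ quotientOpen ρ W ↔ y ∈ Set.range (colimit.ι (affineQuotient ρ) W) := by
  rw [← Set.image_univ]
  rfl

theorem isAffineOpen_quotientOpen (W : StableAffineOpens ρ) : IsAffineOpen (quotientOpen ρ W) :=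
  have : IsAffine ((affineQuotient ρ).obj W) :=
    inferInstanceAs (IsAffine (Spec (CommRingCat.of (invariantSections W.2.2))))
  (isAffineOpen_top _).image_of_isOpenImmersion (colimit.ι (affineQuotient ρ) W)

theorem iSup_quotientOpen : ⨆ W, quotientOpen ρ W = ⊤ := by
  refine top_le_iff.1 fun x _ => ?_
  obtain ⟨W, y, hy⟩ := Scheme.IsLocallyDirected.ι_jointly_surjective (affineQuotient ρ) x
  exact TopologicalSpace.Opens.mem_iSup.2 ⟨W, (mem_quotientOpen ρ W x).2 ⟨y, hy⟩⟩

/-- If `x` maps into the chart of `W`, the identification takes place over some stable `U` contained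
in `W`, so `x` is in the orbit of a point of `U`; stability of `W` puts `x` in `W`. This makes the
quotient map affine. -/
theorem quotientMap_preimage_quotientOpen (W : StableAffineOpens ρ) :
    (quotientMap ρ hρ).left ⁻¹ᵁ quotientOpen ρ W = W.1 := by
  have hq : ∀ (W : StableAffineOpens ρ) (P : Spec Γ(X.left, W.1)),
      (quotientMap ρ hρ).left (W.2.1.fromSpec P) =
        colimit.ι (affineQuotient ρ) W (affineQuotientMap ρ W P) := fun W P => by
    rw [← Scheme.Hom.comp_apply, fromSpec_quotientMap]
    rfl
  ext x
  constructor
  · intro hx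
    obtain ⟨z, hz⟩ := (mem_quotientOpen ρ W _).1 hx
    obtain ⟨W', hW'⟩ := hρ x
    obtain ⟨P, rfl⟩ := exists_fromSpec_eq W'.2.1 hW'
    rw [hq, Scheme.IsLocallyDirected.ι_eq_ι_iff] at hz
    obtain ⟨U, f, f', y, -, hy⟩ := hz
    obtain ⟨Q, rfl⟩ := affineQuotientMap_surjective ρ U y
    obtain ⟨Q', hQ'⟩ := exists_fromSpec_eq W'.2.1 (StableAffineOpens.le f' (fromSpec_mem U.2.1 Q))
    rw [map_affineQuotientMap ρ f' Q Q' hQ'.symm, affineQuotientMap_eq_iff] at hy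
    obtain ⟨g, hg⟩ := hy
    rw [← hg, hQ']
    exact W.2.2 g (StableAffineOpens.le f (fromSpec_mem U.2.1 Q))
  · intro hx
    obtain ⟨P, rfl⟩ := exists_fromSpec_eq W.2.1 hx
    exact (mem_quotientOpen ρ W _).2 ⟨_, (hq W P).symm⟩

theorem isAffineHom_quotientMap : IsAffineHom (quotientMap ρ hρ).left := by
  refine isAffineHom_of_forall_exists_isAffineOpen _ fun y => ?_
  have : y ∈ ⨆ W, quotientOpen ρ W := iSup_quotientOpen ρ ▸ trivial
  obtain ⟨W, hW⟩ := TopologicalSpace.Opens.mem_iSup.1 this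
  refine ⟨quotientOpen ρ W, hW, isAffineOpen_quotientOpen ρ W, ?_⟩
  rw [quotientMap_preimage_quotientOpen]
  exact W.2.1

theorem sectionsEqInvariants_quotientOpen (W : StableAffineOpens ρ) :
    SectionsEqInvariants (act_quotientMap ρ hρ) (quotientOpen ρ W) :=
  sectionsEqInvariants_of_comp_eq (π := quotientMap ρ hρ) (act_quotientMap ρ hρ) W.2.2 W.2.1
    (colimit.ι (affineQuotient ρ) W) (inferInstanceAs (IsOpenImmersion (colimit.ι (affineQuotient ρ) W)))
    (fromSpec_quotientMap ρ hρ W)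
    (quotientMap_preimage_quotientOpen ρ hρ W)

theorem isQuotient_quotientMap : IsQuotient ρ (quotientMap ρ hρ) :=
  have := isAffineHom_quotientMap ρ hρ
  .of_iSup_eq_top (act_quotientMap ρ hρ) (quotientOpen ρ) (isAffineOpen_quotientOpen ρ)
    (iSup_quotientOpen ρ) (sectionsEqInvariants_quotientOpen ρ hρ)

end Quotient

/-! ### Stable affine covers of quasi-projective schemes and the conclusion -/

theorem isSeparated_of_hom {X Y : Scheme.{u}} (f : X ⟶ Y) [IsSeparated f] [Y.IsSeparated] :
    X.IsSeparated := by
  rw [Scheme.isSeparated_iff, ← terminal.comp_from f]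
  infer_instance

section

attribute [local instance] MvPolynomial.gradedAlgebra

theorem IsQuasiProjective.isSeparated {k : Type u} [Field k] {X : Over (Spec (CommRingCat.of k))}
    (hX : IsQuasiProjective X) : X.left.IsSeparated := by
  obtain ⟨n, i, hi⟩ := hX
  let j : X.left ⟶ Proj (MvPolynomial.homogeneousSubmodule (Fin (n + 1)) k) := i.left
  have : IsImmersion j := hi
  exact isSeparated_of_hom j

theorem IsQuasiProjective.exists_isAffineOpen {k : Type u} [Field k]
    {X : Over (Spec (CommRingCat.of k))} (hX : IsQuasiProjective X) (T : Set X.left)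
    (hT : T.Finite) : ∃ U : X.left.Opens, IsAffineOpen U ∧ T ⊆ U := by
  obtain ⟨n, i, hi⟩ := hX
  let j : X.left ⟶ Proj (MvPolynomial.homogeneousSubmodule (Fin (n + 1)) k) := i.left
  have : IsImmersion j := hi
  exact exists_isAffineOpen_proj _ j T hT

end

/-- The intersection of all translates of `U` is stable, contains `x` because `U` contains its
orbit, and is affine by separatedness. -/
theorem exists_stableAffineOpens {S : Scheme.{u}} {G : Type v} [Group G] [Finite G] {X : Over S}
    [X.left.IsSeparated] (ρ : G →* Aut X) (x : X.left)
    (hx : ∃ U : X.left.Opens, IsAffineOpen U ∧ Set.range (fun g => (act ρ g).left x) ⊆ U) :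
    ∃ W : StableAffineOpens ρ, x ∈ W.1 := by
  obtain ⟨U, hU, hxU⟩ := hx
  have hmem : ∀ y, y ∈ (⨅ g, (act ρ g).left ⁻¹ᵁ U) ↔ ∀ g, (act ρ g).left y ∈ U := by
    intro y
    rw [← SetLike.mem_coe, TopologicalSpace.Opens.coe_iInf]
    exact Set.mem_iInter
  refine ⟨⟨⨅ g, (act ρ g).left ⁻¹ᵁ U, IsAffineOpen.iInf fun g => hU.preimage_of_isIso _,
    fun g y hy => ?_⟩, (hmem x).2 fun g => hxU ⟨g, rfl⟩⟩
  refine (hmem _).2 fun h => ?_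
  have := (hmem y).1 hy (h * g)
  rwa [act_mul, Over.comp_left, Scheme.Hom.comp_apply] at this

end QuotientSmoothness

theorem theorem4p5 {k : Type u} [Field k] {p : ℕ} (hp : p.Prime) (hpk : ringChar k ≠ p)
    {G : Type v} [Group G] [Finite G] (hG : Nat.card G = p)
    (X : Over (Spec (CommRingCat.of k))) (hX : IsQuasiProjective X) (hXsm : Smooth X.hom)
    (ρ : G →* Aut X) (hD : IsEffectiveCartierDivisor (fixedLocusι ρ).left) :
    (∃ (Y : Over (Spec (CommRingCat.of k))) (π : X ⟶ Y), IsQuotient ρ π) ∧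
      ∀ (Y : Over (Spec (CommRingCat.of k))) (π : X ⟶ Y), IsQuotient ρ π → Smooth Y.hom := by
  have hpk' : (p : k) ≠ 0 := fun h => by
    rcases (Nat.dvd_prime hp).1 (ringChar.dvd h) with h1 | h1
    · exact CharP.ringChar_ne_one h1
    · exact hpk h1
  have := hX.isSeparated
  refine ⟨⟨quotient ρ, quotientMap ρ fun x => exists_stableAffineOpens ρ x
    (hX.exists_isAffineOpen _ (Set.finite_range _)), isQuotient_quotientMap ρ _⟩,
    fun Y π hπ => hπ.smooth hp hpk' hG hXsm hD⟩
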